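/- Theorem 1.1 (Gavrilov). There exist nontrivial, time-independent, smooth, compactly supported solutions of the 3D incompressible Euler equations. That is, there exist a vector field $u\in (C_0^\infty(\mathbb{R}^3))^3$, not identically zero, and a function $p\in C^\infty(\mathbb{R}^3)$, both independent of time, such that $$\partial_t u+u\cdot\nabla u+\nabla p=0,\qquad \nabla\cdot u=0\qquad\text{on all of }\mathbb{R}\times\mathbb{R}^3 .$$ (Here $\partial_t u=0$, so that $u\cdot\nabla u+\nabla p=0$ on $\mathbb{R}^3$.) Moreover, $u$ can be chosen with support in a toroidal shell that avoids its core circle: there are real numbers $0<a<b<\ell$ such that $$\operatorname{supp} u\subset\{x\in\mathbb{R}^3 : a^2<(r-\ell)^2+z^2<b^2\},\qquad r=\sqrt{x_1^2+x_2^2},\quad z=x_3 .$$ -/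

import Mathlib

open scoped ContDiff

namespace Euler3D

/-- Three dimensional Euclidean space `ℝ³`. -/
abbrev Space : Type := EuclideanSpace ℝ (Fin 3)

/-- The divergence `∇·v = ∂₁v₁ + ∂₂v₂ + ∂₃v₃` of a vector field on `ℝ³`. -/
noncomputable def divergence (v : Space → Space) (x : Space) : ℝ :=
  ∑ i : Fin 3, (fderiv ℝ v x (EuclideanSpace.single i (1 : ℝ))) i

/-- The convective derivative `(v·∇)w = ∑ᵢ vᵢ ∂ᵢw` of vector fields on `ℝ³`. -/
noncomputable def convect (v w : Space → Space) (x : Space) : Space :=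
  ∑ i : Fin 3, (v x) i • fderiv ℝ w x (EuclideanSpace.single i (1 : ℝ))

/-- `(u, p)` is a classical (continuously differentiable) solution, on all of `ℝ × ℝ³`, of the
three dimensional incompressible Euler equations. -/
structure IsEulerSolution (u : ℝ → Space → Space) (p : ℝ → Space → ℝ) : Prop where
  contDiff_velocity : ContDiff ℝ 1 (fun q : ℝ × Space => u q.1 q.2)
  contDiff_pressure : ContDiff ℝ 1 (fun q : ℝ × Space => p q.1 q.2)
  momentum : ∀ (t : ℝ) (x : Space),
    deriv (fun s => u s x) t + convect (u t) (u t) x + gradient (p t) x = 0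
  incompressible : ∀ (t : ℝ) (x : Space), divergence (u t) x = 0

/-- The cylindrical radius `r = √(x₁² + x₂²)`. -/
noncomputable def cylRadius (x : Space) : ℝ := √((x 0) ^ 2 + (x 1) ^ 2)

/-- The open toroidal shell `a² < (r - ℓ)² + z² < b²` around the circle `r = ℓ`, `z = 0`, where
`z = x₃`; for `0 < ℓ`, `0 ≤ a < b` it consists of the points whose distance to that circle lies in `(a, b)`. -/
def toroidalShell (ℓ a b : ℝ) : Set Space :=
  {x | a ^ 2 < (cylRadius x - ℓ) ^ 2 + (x 2) ^ 2 ∧ (cylRadius x - ℓ) ^ 2 + (x 2) ^ 2 < b ^ 2}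

end Euler3D

/-! Seek an axisymmetric flow whose pressure is its own stream function. With `w = r²/2`, take `u_r
= ψ_z / r`, `u_z = -ψ_w`, a swirl for which `r u_θ` depends on `ψ` only, and `p = ψ`. As `u·∇ψ = 0`,
multiplying `u` by `φ(ψ)` keeps the equations true, with pressure `P(ψ)`, `P' = φ²`
(`IsLocalSolution.isAxisymSolutionAt`). If `φ` lives on a narrow band of positive values, the flow
is cut off to a compact shell around a strict minimum of `ψ`. A local solution near one circle is
therefore enough.

The axial equation holds as soon as `ψ_w = w + k(ψ)`. The normalization `|u|² = 3p` then fixes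
`ψ_z²` as a function of `w` and `ψ` (`energy`), once `(r u_θ)²` is `swirlSq`. This system for `ψ` is
overdetermined. Its compatibility condition is an identity in `w` that holds exactly because `k' =
3/T` and `(xT)' = -4k + 18x/T`, an ODE singular at `x = 0` and solved by a contraction
(`exists_profile`).

`IsProfile.exists_localSolution` builds `ψ` by solving along `w = 1`, where `ψ = ρ²`, and then
flowing in `w`. At the core `ψ = 0` only low regularity is available, but the cut-off removes the
core. Where `ψ > 0` everything is smooth by bootstrapping. -/

namespace Gavrilov

open Set Filter Topology

/-! ### The singular profile ODE, by contraction -/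

/-- The primitive `-1 + ∫₀ʸ 3 / t`. -/
noncomputable def slopePrim (t : ℝ → ℝ) (y : ℝ) : ℝ := -1 + ∫ s in (0 : ℝ)..y, 3 / t s

/-- The integrand of the singular integral equation for the profile. -/
noncomputable def profileRHS (t : ℝ → ℝ) (y : ℝ) : ℝ := -4 * slopePrim t y + 18 * y / t y

/-- The average of `profileRHS t` over `[0, x]`. -/
noncomputable def profileAvg (t : ℝ → ℝ) (x : ℝ) : ℝ :=
  ∫ σ in (0 : ℝ)..1, profileRHS t (x * σ)

lemma hasDerivAt_slopePrim {t : ℝ → ℝ} (ht : Continuous t) (h3 : ∀ y, 3 ≤ t y) (y : ℝ) :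
    HasDerivAt (slopePrim t) (3 / t y) y := by
  have hc : Continuous fun s => 3 / t s :=
    continuous_const.div ht fun s => by linarith [h3 s]
  exact (intervalIntegral.integral_hasDerivAt_right (hc.intervalIntegrable _ _)
    hc.aestronglyMeasurable.stronglyMeasurableAtFilter hc.continuousAt).const_add (-1)

lemma continuous_slopePrim {t : ℝ → ℝ} (ht : Continuous t) (h3 : ∀ y, 3 ≤ t y) :
    Continuous (slopePrim t) :=
  continuous_iff_continuousAt.2 fun y => (hasDerivAt_slopePrim ht h3 y).continuousAt

lemma continuous_profileRHS {t : ℝ → ℝ} (ht : Continuous t) (h3 : ∀ y, 3 ≤ t y) :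
    Continuous (profileRHS t) := by
  unfold profileRHS
  exact (continuous_const.mul (continuous_slopePrim ht h3)).add
    ((continuous_const.mul continuous_id).div ht fun s => by linarith [h3 s])

lemma continuous_profileAvg {t : ℝ → ℝ} (ht : Continuous t) (h3 : ∀ y, 3 ≤ t y) :
    Continuous (profileAvg t) := by
  unfold profileAvg
  have := continuous_profileRHS ht h3
  exact intervalIntegral.continuous_parametric_intervalIntegral_of_continuous' (by fun_prop) _ _

lemma abs_div_sub_div_le {a b c d : ℝ} (ha : 3 ≤ a) (hb : 3 ≤ b) (hd : |a - b| ≤ d) :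
    |c / a - c / b| ≤ |c| * (d / 9) := by
  have h : c / a - c / b = c * ((b - a) / (a * b)) := by
    field_simp [show a ≠ 0 by linarith, show b ≠ 0 by linarith]
  rw [h, abs_mul]
  refine mul_le_mul_of_nonneg_left ?_ (abs_nonneg c)
  have hab : 9 ≤ a * b := by nlinarith
  rw [abs_div, abs_of_pos (by linarith : 0 < a * b), abs_sub_comm]
  have hd0 := (abs_nonneg _).trans hd
  exact div_le_div₀ hd0 hd (by norm_num) hab

lemma abs_slopePrim_sub_le {t u : ℝ → ℝ} (ht : Continuous t) (h3 : ∀ y, 3 ≤ t y)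
    (hu : Continuous u) (hu3 : ∀ y, 3 ≤ u y) {d : ℝ} (hd : ∀ y, |t y - u y| ≤ d) (y : ℝ) :
    |slopePrim t y - slopePrim u y| ≤ d / 3 * |y| := by
  have c1 : Continuous fun s => 3 / t s :=
    continuous_const.div ht fun s => by linarith [h3 s]
  have c2 : Continuous fun s => 3 / u s :=
    continuous_const.div hu fun s => by linarith [hu3 s]
  have e : slopePrim t y - slopePrim u y = ∫ s in (0 : ℝ)..y, (3 / t s - 3 / u s) := by
    rw [intervalIntegral.integral_sub (c1.intervalIntegrable _ _) (c2.intervalIntegrable _ _)]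
    simp [slopePrim]
  rw [e]
  have := intervalIntegral.norm_integral_le_of_norm_le_const (a := 0) (b := y) (C := d / 3)
    (f := fun s => 3 / t s - 3 / u s) fun s _ => by
      have := abs_div_sub_div_le (c := 3) (h3 s) (hu3 s) (hd s)
      rw [Real.norm_eq_abs]
      refine this.trans (le_of_eq ?_)
      rw [abs_of_pos (by norm_num : (0 : ℝ) < 3)]; ring
  simpa using this

/-- The radius `1/100` enters here: the two terms contribute `4d/300` and `2d/100`, well below the
contraction constant `1/2`. -/
lemma abs_profileRHS_sub_le {t u : ℝ → ℝ} (ht : Continuous t) (h3 : ∀ y, 3 ≤ t y)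
    (hu : Continuous u) (hu3 : ∀ y, 3 ≤ u y) {d : ℝ} (hd : ∀ y, |t y - u y| ≤ d)
    {y : ℝ} (hy : |y| ≤ 1 / 100) : |profileRHS t y - profileRHS u y| ≤ d / 2 := by
  have hd0 : 0 ≤ d := (abs_nonneg _).trans (hd 0)
  have h1 := abs_slopePrim_sub_le ht h3 hu hu3 hd y
  have h2 := abs_div_sub_div_le (c := 18 * y) (h3 y) (hu3 y) (hd y)
  have h1' : d / 3 * |y| ≤ d / 3 * (1 / 100) := by gcongr
  have h2' : |18 * y| * (d / 9) ≤ (18 * (1 / 100)) * (d / 9) := by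
    rw [abs_mul, abs_of_pos (by norm_num : (0 : ℝ) < 18)]; gcongr
  unfold profileRHS
  rw [abs_le] at *
  constructor <;> linarith [h1.1, h1.2, h2.1, h2.2]

lemma abs_profileAvg_sub_le {t u : ℝ → ℝ} (ht : Continuous t) (h3 : ∀ y, 3 ≤ t y)
    (hu : Continuous u) (hu3 : ∀ y, 3 ≤ u y) {d : ℝ} (hd : ∀ y, |t y - u y| ≤ d)
    {x : ℝ} (hx : |x| ≤ 1 / 100) : |profileAvg t x - profileAvg u x| ≤ d / 2 := by
  have c1 := continuous_profileRHS ht h3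
  have c2 := continuous_profileRHS hu hu3
  unfold profileAvg
  rw [← intervalIntegral.integral_sub
    (Continuous.intervalIntegrable (by fun_prop) _ _)
    (Continuous.intervalIntegrable (by fun_prop) _ _)]
  have := intervalIntegral.norm_integral_le_of_norm_le_const (a := 0) (b := 1) (C := d / 2)
    (f := fun s => profileRHS t (x * s) - profileRHS u (x * s)) fun s hs => by
      rw [uIoc_of_le zero_le_one] at hs
      refine abs_profileRHS_sub_le ht h3 hu hu3 hd ?_
      rw [abs_mul, abs_of_pos hs.1]
      nlinarith [abs_nonneg x, hs.2, hs.1]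
  simpa using this

lemma abs_slopePrim_add_one_le {t : ℝ → ℝ} (h3 : ∀ y, 3 ≤ t y) (y : ℝ) :
    |slopePrim t y + 1| ≤ |y| := by
  have := intervalIntegral.norm_integral_le_of_norm_le_const (a := 0) (b := y) (C := 1)
    (f := fun s => 3 / t s) fun s _ => by
      have := h3 s
      rw [Real.norm_eq_abs, abs_of_pos (by positivity), div_le_one (by linarith)]
      exact this
  simpa [slopePrim] using this

/-- The value at `y = 0` is exactly `4`; the two terms move it by at most `4/100` and `6/100`. -/
lemma abs_profileRHS_sub_four_le {t : ℝ → ℝ} (h3 : ∀ y, 3 ≤ t y)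
    {y : ℝ} (hy : |y| ≤ 1 / 100) : |profileRHS t y - 4| ≤ 1 / 10 := by
  have h1 := (abs_slopePrim_add_one_le h3 y).trans hy
  have h2 : |18 * y / t y| ≤ 6 * (1 / 100) := by
    have h3y := h3 y
    rw [abs_div, abs_mul, abs_of_pos (by norm_num : (0 : ℝ) < 18),
      abs_of_pos (by linarith : 0 < t y), div_le_iff₀ (by linarith)]
    nlinarith [abs_nonneg y]
  unfold profileRHS
  rw [abs_le] at *
  constructor <;> linarith [h1.1, h1.2, h2.1, h2.2]

lemma abs_profileAvg_sub_four_le {t : ℝ → ℝ} (ht : Continuous t) (h3 : ∀ y, 3 ≤ t y)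
    {x : ℝ} (hx : |x| ≤ 1 / 100) : |profileAvg t x - 4| ≤ 1 / 10 := by
  have c1 := continuous_profileRHS ht h3
  have e : profileAvg t x - 4 = ∫ σ in (0 : ℝ)..1, (profileRHS t (x * σ) - 4) := by
    rw [intervalIntegral.integral_sub (Continuous.intervalIntegrable (by fun_prop) _ _)
      (by simp)]
    simp [profileAvg]
  rw [e]
  have := intervalIntegral.norm_integral_le_of_norm_le_const (a := 0) (b := 1) (C := 1 / 10)
    (f := fun s => profileRHS t (x * s) - 4) fun s hs => by
      rw [uIoc_of_le zero_le_one] at hs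
      refine abs_profileRHS_sub_four_le h3 ?_
      rw [abs_mul, abs_of_pos hs.1]
      nlinarith [abs_nonneg x, hs.2, hs.1]
  simpa using this

/-- The cut-off extension to the line of a function on `[-1/100, 1/100]`. -/
noncomputable def clampExt (T : C(Icc (-1 / 100 : ℝ) (1 / 100), ℝ)) (y : ℝ) : ℝ :=
  max 3 (min 5 (IccExtend (by norm_num : (-1 / 100 : ℝ) ≤ 1 / 100) T y))

lemma continuous_clampExt (T : C(Icc (-1 / 100 : ℝ) (1 / 100), ℝ)) : Continuous (clampExt T) :=
  continuous_const.max (continuous_const.min T.continuous.Icc_extend')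

lemma three_le_clampExt (T : C(Icc (-1 / 100 : ℝ) (1 / 100), ℝ)) (y : ℝ) : 3 ≤ clampExt T y :=
  le_max_left _ _

lemma abs_clampExt_sub_le (T U : C(Icc (-1 / 100 : ℝ) (1 / 100), ℝ)) (y : ℝ) :
    |clampExt T y - clampExt U y| ≤ dist T U := by
  unfold clampExt IccExtend
  set q := projIcc (-1 / 100 : ℝ) (1 / 100) (by norm_num) y
  have h : |T q - U q| ≤ dist T U := by
    have := ContinuousMap.dist_apply_le_dist (f := T) (g := U) q
    rwa [Real.dist_eq] at this
  refine le_trans ?_ h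
  have h1 := abs_max_sub_max_le_max (3 : ℝ) (min 5 (T q)) 3 (min 5 (U q))
  have h2 := abs_min_sub_min_le_max (5 : ℝ) (T q) 5 (U q)
  simp only [sub_self, abs_zero] at h1 h2
  rw [max_eq_right (a := (0 : ℝ)) (abs_nonneg _)] at h1 h2
  exact h1.trans h2

/-- The contraction whose fixed point is the profile. -/
noncomputable def profileMap (T : C(Icc (-1 / 100 : ℝ) (1 / 100), ℝ)) :
    C(Icc (-1 / 100 : ℝ) (1 / 100), ℝ) where
  toFun x := profileAvg (clampExt T) x
  continuous_toFun :=
    (continuous_profileAvg (continuous_clampExt T) (three_le_clampExt T)).comp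
      continuous_subtype_val

lemma contractingWith_profileMap : ContractingWith (1 / 2) profileMap := by
  refine ⟨by norm_num, LipschitzWith.of_dist_le_mul fun T U => ?_⟩
  rw [ContinuousMap.dist_le (by positivity)]
  intro x
  have hx : |(x : ℝ)| ≤ 1 / 100 := abs_le.2 ⟨by linarith [x.2.1], x.2.2⟩
  have := abs_profileAvg_sub_le (continuous_clampExt T) (three_le_clampExt T)
    (continuous_clampExt U) (three_le_clampExt U) (abs_clampExt_sub_le T U) hx
  rw [Real.dist_eq]
  refine this.trans (le_of_eq ?_)
  simp; ring

/-- Solution of the singular ODE system `k' = 3 / T`, `(x T)' = -4 k + 18 x / T` with `k 0 = -1`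
and `T` regular at `0`. -/
theorem exists_profile : ∃ T k : ℝ → ℝ, Continuous T ∧ (∀ x, |T x - 4| ≤ 1 / 10) ∧ k 0 = -1 ∧
    (∀ x, HasDerivAt k (3 / T x) x) ∧
    ∀ x ∈ Ioo (-1 / 100 : ℝ) (1 / 100),
      HasDerivAt (fun y => y * T y) (-4 * k x + 18 * x / T x) x := by
  obtain ⟨T, hT⟩ : ∃ T, profileMap T = T :=
    ⟨_, contractingWith_profileMap.fixedPoint_isFixedPt⟩
  have hne : (-1 / 100 : ℝ) ≤ 1 / 100 := by norm_num
  set t := clampExt T with ht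
  have ct := continuous_clampExt T
  have h3 := three_le_clampExt T
  have key : ∀ x : Icc (-1 / 100 : ℝ) (1 / 100), T x = profileAvg t x := fun x => by
    conv_lhs => rw [← hT]
    rfl
  have hb : ∀ x, |T x - 4| ≤ 1 / 10 := fun x => by
    rw [key]
    exact abs_profileAvg_sub_four_le ct h3 (abs_le.2 ⟨by linarith [x.2.1], x.2.2⟩)
  -- The fixed point stays within `1/10` of `4`, so the truncation to `[3, 5]` never acts on it.
  have hext : ∀ y, t y = T (projIcc _ _ hne y) := fun y => by
    have := abs_le.1 (hb (projIcc _ _ hne y))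
    rw [ht]
    unfold clampExt IccExtend
    rw [Function.comp, min_eq_right (by linarith [this.2]), max_eq_right (by linarith [this.1])]
  have hval : ∀ x ∈ Icc (-1 / 100 : ℝ) (1 / 100), x * t x = ∫ s in (0 : ℝ)..x, profileRHS t s := by
    intro x hx
    rw [hext, projIcc_of_mem hne hx, key]
    unfold profileAvg
    simp
  refine ⟨t, slopePrim t, ct, fun x => ?_, by simp [slopePrim], hasDerivAt_slopePrim ct h3,
    fun x hx => ?_⟩
  · rw [hext]; exact hb _
  · have c := continuous_profileRHS ct h3
    have h := intervalIntegral.integral_hasDerivAt_right (c.intervalIntegrable 0 x)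
      c.aestronglyMeasurable.stronglyMeasurableAtFilter c.continuousAt
    refine h.congr_of_eventuallyEq ?_
    filter_upwards [Ioo_mem_nhds hx.1 hx.2] with y hy
    exact hval y (Ioo_subset_Icc_self hy)

/-! ### Smoothness of the profile away from zero -/

/-- Bootstrap: if the derivative of `G` is a smooth function of the point and the value of `G`,
then `G` is smooth. -/
theorem contDiffOn_of_hasFDerivAt_comp {E F : Type*} [NormedAddCommGroup E] [NormedSpace ℝ E]
    [NormedAddCommGroup F] [NormedSpace ℝ F] {G : E → F} {H : E × F → (E →L[ℝ] F)}
    {V : Set E} {W : Set (E × F)} (hV : IsOpen V) (hH : ContDiffOn ℝ ∞ H W)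
    (hVW : ∀ x ∈ V, (x, G x) ∈ W) (hG : ∀ x ∈ V, HasFDerivAt G (H (x, G x)) x) :
    ContDiffOn ℝ ∞ G V := by
  refine contDiffOn_infty.2 fun n => ?_
  induction n with
  | zero =>
    exact contDiffOn_zero.2 fun x hx => (hG x hx).continuousAt.continuousWithinAt
  | succ n ih =>
    push_cast
    rw [contDiffOn_succ_iff_fderiv_of_isOpen hV]
    refine ⟨fun x hx => (hG x hx).differentiableAt.differentiableWithinAt, by simp, ?_⟩
    have : ContDiffOn ℝ n (fun x => H (x, G x)) V :=
      (hH.of_le (by exact_mod_cast le_top)).comp (contDiffOn_id.prodMk ih) hVW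
    exact this.congr fun x hx => (hG x hx).fderiv

lemma contDiffOn_of_hasDerivAt_comp {F : Type*}
    [NormedAddCommGroup F] [NormedSpace ℝ F] {G : ℝ → F} {H : ℝ × F → F}
    {V : Set ℝ} {W : Set (ℝ × F)} (hV : IsOpen V) (hH : ContDiffOn ℝ ∞ H W)
    (hVW : ∀ x ∈ V, (x, G x) ∈ W) (hG : ∀ x ∈ V, HasDerivAt G (H (x, G x)) x) :
    ContDiffOn ℝ ∞ G V :=
  contDiffOn_of_hasFDerivAt_comp (H := fun q => ContinuousLinearMap.toSpanSingleton ℝ (H q)) hV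
    ((ContinuousLinearMap.toSpanSingletonCLE (𝕜 := ℝ) (E := F)).contDiff.comp_contDiffOn hH)
    hVW fun x hx => (hG x hx).hasFDerivAt

/-- The data of the singular ODE for the profile. -/
structure IsProfile (T k : ℝ → ℝ) : Prop where
  continuous : Continuous T
  abs_sub_le : ∀ x, |T x - 4| ≤ 1 / 10
  k_zero : k 0 = -1
  hasDerivAt_k : ∀ x, HasDerivAt k (3 / T x) x
  hasDerivAt_mul : ∀ x ∈ Ioo (-1 / 100 : ℝ) (1 / 100),
      HasDerivAt (fun y => y * T y) (-4 * k x + 18 * x / T x) x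

namespace IsProfile

variable {T k : ℝ → ℝ}

/-- Off `x = 0` the equation can be solved for `T'`, which gives a first-order system with smooth
right-hand side, and the bootstrap applies. -/
lemma contDiffOn (h : IsProfile T k) : ContDiffOn ℝ ∞ (fun x => (T x, k x)) (Ioo 0 (1 / 100)) := by
  refine contDiffOn_of_hasDerivAt_comp
    (H := fun q => ((-4 * q.2.2 + 18 * q.1 / q.2.1 - q.2.1) / q.1, 3 / q.2.1))
    (W := {q | q.1 ≠ 0 ∧ q.2.1 ≠ 0}) isOpen_Ioo ?_ ?_ ?_
  · refine ContDiffOn.prodMk ?_ ?_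
    · refine ContDiffOn.div (ContDiffOn.sub (ContDiffOn.add (by fun_prop)
        (ContDiffOn.div (by fun_prop) (by fun_prop) fun q hq => hq.2)) (by fun_prop))
        (by fun_prop) fun q hq => hq.1
    · exact ContDiffOn.div (by fun_prop) (by fun_prop) fun q hq => hq.2
  · intro x hx
    have := (abs_le.1 (h.abs_sub_le x)).1
    exact ⟨hx.1.ne', by simp only; linarith⟩
  · intro x hx
    have h0 : x ≠ 0 := hx.1.ne'
    refine HasDerivAt.prodMk ?_ (h.hasDerivAt_k x)
    have h1 := (h.hasDerivAt_mul x ⟨by linarith [hx.1], hx.2⟩).div (hasDerivAt_id x) h0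
    refine (h1.congr_of_eventuallyEq ?_).congr_deriv ?_
    · filter_upwards [isOpen_ne.mem_nhds h0] with y hy
      simp only [Pi.div_apply, id]
      field_simp [show y ≠ 0 from hy]
    · simp only [id]; field_simp

end IsProfile

/-! ### The flow in `w` and its dependence on the initial value -/

lemma hasDerivAt_primitive {q : ℝ → ℝ} (hq : Continuous q) (a w : ℝ) :
    HasDerivAt (fun v => ∫ s in a..v, q s) (q w) w :=
  intervalIntegral.integral_hasDerivAt_right (hq.intervalIntegrable _ _)
    hq.aestronglyMeasurable.stronglyMeasurableAtFilter hq.continuousAt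

lemma eq_mul_exp_of_hasDerivAt_mul {y q : ℝ → ℝ} {a b c : ℝ} (hq : Continuous q)
    (hc : c ∈ Ioo a b) (hy : ∀ w ∈ Ioo a b, HasDerivAt y (q w * y w) w)
    {w : ℝ} (hw : w ∈ Ioo a b) : y w = y c * Real.exp (∫ s in c..w, q s) := by
  have hd : ∀ v ∈ Ioo a b, HasDerivAt (fun v => y v * Real.exp (-∫ s in c..v, q s)) 0 v := by
    intro v hv
    refine ((hy v hv).mul (hasDerivAt_primitive hq c v).neg.exp).congr_deriv ?_
    ring
  have := isOpen_Ioo.is_const_of_deriv_eq_zero isPreconnected_Ioo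
    (fun v hv => (hd v hv).differentiableAt.differentiableWithinAt)
    (fun v hv => (hd v hv).deriv) hw hc
  simp only [intervalIntegral.integral_same, neg_zero, Real.exp_zero, mul_one] at this
  rw [← this, mul_assoc, ← Real.exp_add]
  simp

namespace IsProfile

variable {T k : ℝ → ℝ}

lemma T_pos (h : IsProfile T k) (x : ℝ) : 0 < T x := by
  linarith [(abs_le.1 (h.abs_sub_le x)).1]

lemma continuous_k (h : IsProfile T k) : Continuous k :=
  continuous_iff_continuousAt.2 fun x => (h.hasDerivAt_k x).continuousAt

lemma continuous_slope (h : IsProfile T k) : Continuous fun x => 3 / T x :=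
  continuous_const.div h.continuous fun x => (h.T_pos x).ne'

lemma lipschitzWith_k (h : IsProfile T k) : LipschitzWith 1 k := by
  refine lipschitzWith_of_nnnorm_deriv_le (fun x => (h.hasDerivAt_k x).differentiableAt) fun x => ?_
  rw [(h.hasDerivAt_k x).deriv, ← NNReal.coe_le_coe, coe_nnnorm, Real.norm_eq_abs]
  have := (abs_le.1 (h.abs_sub_le x)).1
  rw [abs_of_pos (div_pos (by norm_num) (h.T_pos x)), NNReal.coe_one,
    div_le_one (h.T_pos x)]
  linarith

lemma abs_k_add_one_le (h : IsProfile T k) (x : ℝ) : |k x + 1| ≤ |x| := by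
  have := h.lipschitzWith_k.dist_le_mul x 0
  simpa [Real.dist_eq, h.k_zero] using this

/-- Since `k 0 = -1`, the speed is at most `|w - 1| + |k x + 1| ≤ 5/4 ≤ 2`. Over time `1/4` a
solution moves by at most `1/2`, less than the margin `1 - 1/4`. -/
lemma isPicardLindelof (h : IsProfile T k) :
    IsPicardLindelof (fun w x : ℝ => w + k x) (tmin := 3 / 4) (tmax := 5 / 4)
      ⟨1, by norm_num, by norm_num⟩ 0 1 (1 / 4) 2 1 where
  lipschitzOnWith w _ := by
    refine LipschitzWith.lipschitzOnWith (LipschitzWith.of_dist_le_mul fun x y => ?_)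
    have := h.lipschitzWith_k.dist_le_mul x y
    simpa [Real.dist_eq] using this
  continuousOn x _ := by fun_prop
  norm_le w hw x hx := by
    have h1 := h.abs_k_add_one_le x
    have h2 : |x| ≤ 1 := by simpa using hx
    rw [Real.norm_eq_abs]
    have := abs_le.1 (h1.trans h2)
    refine abs_le.2 ⟨?_, ?_⟩ <;> norm_num <;> linarith [hw.1, hw.2]
  mul_max_le := by norm_num

lemma exists_flow_continuous (h : IsProfile T k) : ∃ Φ : ℝ → ℝ → ℝ,
    Continuous (fun q : ℝ × ℝ => Φ q.1 q.2) ∧ (∀ s ∈ Ioo (-1 / 4 : ℝ) (1 / 4), Φ s 1 = s) ∧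
    ∀ s ∈ Ioo (-1 / 4 : ℝ) (1 / 4), ∀ w ∈ Ioo (3 / 4 : ℝ) (5 / 4),
      HasDerivAt (Φ s) (w + k (Φ s w)) w := by
  obtain ⟨α, hα, hc⟩ := h.isPicardLindelof.exists_forall_mem_closedBall_eq_hasDerivWithinAt_continuousOn
  have n1 : (-1 / 4 : ℝ) ≤ 1 / 4 := by norm_num
  have n2 : (3 / 4 : ℝ) ≤ 5 / 4 := by norm_num
  have hball : ∀ s ∈ Icc (-1 / 4 : ℝ) (1 / 4), s ∈ Metric.closedBall (0 : ℝ) ((1 / 4 : NNReal) : ℝ) := by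
    intro s hs
    rw [mem_closedBall_zero_iff, Real.norm_eq_abs]
    exact abs_le.2 ⟨by push_cast; linarith [hs.1], by push_cast; linarith [hs.2]⟩
  have heq : ∀ s ∈ Ioo (-1 / 4 : ℝ) (1 / 4), ∀ w ∈ Icc (3 / 4 : ℝ) (5 / 4),
      α (projIcc _ _ n1 s, projIcc _ _ n2 w) = α (s, w) := fun s hs w hw => by
    rw [projIcc_of_mem n1 (Ioo_subset_Icc_self hs), projIcc_of_mem n2 hw]
  -- Projecting both arguments onto the rectangle makes the flow continuous everywhere without
  -- changing it inside.
  refine ⟨fun s w => α (projIcc _ _ n1 s, projIcc _ _ n2 w), ?_, fun s hs => ?_,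
    fun s hs w hw => ?_⟩
  · refine hc.comp_continuous (by fun_prop) fun q => ⟨hball _ (Subtype.prop _), Subtype.prop _⟩
  · beta_reduce
    rw [heq s hs 1 (by constructor <;> norm_num)]
    exact (hα s (hball s (Ioo_subset_Icc_self hs))).1
  · have := ((hα s (hball s (Ioo_subset_Icc_self hs))).2 w (Ioo_subset_Icc_self hw)).hasDerivAt
      (Icc_mem_nhds hw.1 hw.2)
    beta_reduce
    rw [heq s hs w (Ioo_subset_Icc_self hw)]
    refine this.congr_of_eventuallyEq ?_
    filter_upwards [Ioo_mem_nhds hw.1 hw.2] with v hv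
    exact heq s hs v (Ioo_subset_Icc_self hv)

/-- The mean slope of `k` between two points. -/
lemma exists_mean_slope (h : IsProfile T k) : ∃ κ : ℝ → ℝ → ℝ,
    Continuous (fun q : ℝ × ℝ => κ q.1 q.2) ∧ (∀ a, κ a a = 3 / T a) ∧
    ∀ a b, k b - k a = κ a b * (b - a) := by
  have hc := h.continuous_slope
  refine ⟨fun a b => ∫ τ in (0 : ℝ)..1, 3 / T (a + τ * (b - a)), ?_, fun a => by simp,
    fun a b => ?_⟩
  · refine intervalIntegral.continuous_parametric_intervalIntegral_of_continuous'
      (f := fun (q : ℝ × ℝ) τ => 3 / T (q.1 + τ * (q.2 - q.1))) ?_ _ _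
    exact hc.comp (g := fun x => 3 / T x) (f := fun x : (ℝ × ℝ) × ℝ =>
      x.1.1 + x.2 * (x.1.2 - x.1.1)) (by fun_prop)
  · rw [← intervalIntegral.integral_mul_const]
    have hd : ∀ τ ∈ uIcc (0 : ℝ) 1, HasDerivAt (fun τ => k (a + τ * (b - a)))
        (3 / T (a + τ * (b - a)) * (b - a)) τ := fun τ _ => by
      have h1 : HasDerivAt (fun τ : ℝ => a + τ * (b - a)) (b - a) τ := by
        simpa using ((hasDerivAt_id τ).mul_const (b - a)).const_add a
      exact (h.hasDerivAt_k _).comp τ h1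
    have hi : Continuous fun τ : ℝ => 3 / T (a + τ * (b - a)) * (b - a) :=
      (hc.comp (g := fun x => 3 / T x) (f := fun τ : ℝ => a + τ * (b - a)) (by fun_prop)).mul
        continuous_const
    rw [intervalIntegral.integral_eq_sub_of_hasDerivAt hd (hi.intervalIntegrable _ _)]
    simp

/-- The flow of `dψ/dw = w + k ψ` started at `w = 1`, with its derivative `E` in the initial
value. -/
theorem exists_flow (h : IsProfile T k) : ∃ Φ E : ℝ → ℝ → ℝ,
    Continuous (fun q : ℝ × ℝ => Φ q.1 q.2) ∧ Continuous (fun q : ℝ × ℝ => E q.1 q.2) ∧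
    (∀ s ∈ Ioo (-1 / 4 : ℝ) (1 / 4), Φ s 1 = s) ∧ (∀ s, E s 1 = 1) ∧ (∀ s w, 0 < E s w) ∧
    ∀ s ∈ Ioo (-1 / 4 : ℝ) (1 / 4), ∀ w ∈ Ioo (3 / 4 : ℝ) (5 / 4),
      HasDerivAt (Φ s) (w + k (Φ s w)) w ∧ HasDerivAt (fun s => Φ s w) (E s w) s ∧
      HasDerivAt (E s) (3 / T (Φ s w) * E s w) w := by
  obtain ⟨Φ, hΦ, h1, hd⟩ := h.exists_flow_continuous
  obtain ⟨κ, hκ, hκa, hκs⟩ := h.exists_mean_slope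
  have hsl := h.continuous_slope
  have cI : Continuous fun p : (ℝ × ℝ) × ℝ => ∫ v in (1 : ℝ)..p.2, κ (Φ p.1.1 v) (Φ p.1.2 v) :=
    intervalIntegral.continuous_parametric_primitive_of_continuous
      (f := fun (p : ℝ × ℝ) v => κ (Φ p.1 v) (Φ p.2 v))
      (hκ.comp (f := fun x : (ℝ × ℝ) × ℝ => (Φ x.1.1 x.2, Φ x.1.2 x.2))
        ((hΦ.comp (f := fun x : (ℝ × ℝ) × ℝ => (x.1.1, x.2)) (by fun_prop)).prodMk
        (hΦ.comp (f := fun x : (ℝ × ℝ) × ℝ => (x.1.2, x.2)) (by fun_prop))))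
  have cslice : ∀ s, Continuous (Φ s) := fun s =>
    hΦ.comp (f := fun w : ℝ => (s, w)) (by fun_prop)
  have cq : ∀ s s', Continuous fun v => κ (Φ s v) (Φ s' v) := fun s s' =>
    hκ.comp (f := fun v => (Φ s v, Φ s' v)) ((cslice s).prodMk (cslice s'))
  -- The difference of two trajectories solves a linear equation whose coefficient is the mean slope
  -- of `k`. Dividing by `s' - s` and letting `s' → s` differentiates the flow using only that `k`
  -- is `C¹`.
  have diff : ∀ s ∈ Ioo (-1 / 4 : ℝ) (1 / 4), ∀ s' ∈ Ioo (-1 / 4 : ℝ) (1 / 4),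
      ∀ w ∈ Ioo (3 / 4 : ℝ) (5 / 4),
      Φ s' w - Φ s w = (s' - s) * Real.exp (∫ v in (1 : ℝ)..w, κ (Φ s v) (Φ s' v)) := by
    intro s hs s' hs' w hw
    have := eq_mul_exp_of_hasDerivAt_mul (y := fun v => Φ s' v - Φ s v) (c := 1) (cq s s')
      (by constructor <;> norm_num) (fun v hv => by
        refine ((hd s' hs' v hv).sub (hd s hs v hv)).congr_deriv ?_
        rw [← hκs]; ring) hw
    simp only [h1 s hs, h1 s' hs'] at this
    exact this
  refine ⟨Φ, fun s w => Real.exp (∫ v in (1 : ℝ)..w, κ (Φ s v) (Φ s v)), hΦ,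
    Real.continuous_exp.comp (cI.comp (f := fun q : ℝ × ℝ => ((q.1, q.1), q.2)) (by fun_prop)),
    h1, fun s => by simp, fun s w => Real.exp_pos _,
    fun s hs w hw => ⟨hd s hs w hw, ?_, ?_⟩⟩
  · rw [hasDerivAt_iff_tendsto_slope]
    have ct : Tendsto (fun s' => Real.exp (∫ v in (1 : ℝ)..w, κ (Φ s v) (Φ s' v))) (𝓝[≠] s)
        (𝓝 (Real.exp (∫ v in (1 : ℝ)..w, κ (Φ s v) (Φ s v)))) := by
      have : Continuous fun s' => Real.exp (∫ v in (1 : ℝ)..w, κ (Φ s v) (Φ s' v)) :=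
        Real.continuous_exp.comp (cI.comp (f := fun s' : ℝ => ((s, s'), w)) (by fun_prop))
      exact (this.tendsto s).mono_left nhdsWithin_le_nhds
    refine ct.congr' ?_
    filter_upwards [self_mem_nhdsWithin, nhdsWithin_le_nhds (Ioo_mem_nhds hs.1 hs.2)]
      with s' hne hs'
    rw [slope_def_field, diff s hs s' hs' w hw, mul_div_cancel_left₀ _ (sub_ne_zero.2 hne)]
  · refine (hasDerivAt_primitive (cq s s) 1 w).exp.congr_deriv ?_
    rw [hκa]; ring

end IsProfile

/-! ### Calculus in one and two variables at low regularity -/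

/-- Solution of an autonomous scalar ODE whose speed is continuous and bounded between positive
constants. -/
lemma exists_solution_of_bounded_speed {v : ℝ → ℝ} (hv : Continuous v) {c C : ℝ} (hc : 0 < c)
    (hcv : ∀ x, c ≤ v x) (hvC : ∀ x, v x ≤ C) :
    ∃ ρ : ℝ → ℝ, Continuous ρ ∧ ρ 0 = 0 ∧ Function.Injective ρ ∧
      ∀ z, HasDerivAt ρ (v (ρ z)) z := by
  have vpos : ∀ x, 0 < v x := fun x => hc.trans_le (hcv x)
  have hC : 0 < C := (vpos 0).trans_le (hvC 0)
  have ci : Continuous fun x => (v x)⁻¹ := hv.inv₀ fun x => (vpos x).ne'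
  -- Separation of variables: `g` is the travel time, and the solution is its inverse. The upper
  -- bound on the speed makes `g` grow at least linearly, hence surjective.
  set g : ℝ → ℝ := fun x => ∫ s in (0 : ℝ)..x, (v s)⁻¹ with hg
  have hd : ∀ x, HasDerivAt g (v x)⁻¹ x := hasDerivAt_primitive ci 0
  have g0 : g 0 = 0 := by simp [hg]
  have hmono : StrictMono g := strictMono_of_deriv_pos fun x => by
    rw [(hd x).deriv]; exact inv_pos.2 (vpos x)
  have hdiff : Monotone fun x => g x - C⁻¹ * x := by
    have hd' : ∀ x, HasDerivAt (fun x => g x - C⁻¹ * x) ((v x)⁻¹ - C⁻¹) x := fun x => 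
      ((hd x).sub ((hasDerivAt_id x).const_mul C⁻¹)).congr_deriv (by simp)
    refine monotone_of_deriv_nonneg (fun x => (hd' x).differentiableAt) fun x => ?_
    rw [(hd' x).deriv, sub_nonneg]
    exact inv_anti₀ (vpos x) (hvC x)
  have hsurj : Function.Surjective g := by
    refine Continuous.surjective
      (continuous_iff_continuousAt.2 fun x => (hd x).continuousAt) ?_ ?_
    · refine tendsto_atTop_mono' _ ?_ (tendsto_id.const_mul_atTop (inv_pos.2 hC))
      filter_upwards [eventually_ge_atTop 0] with x hx
      have := hdiff hx
      simp only [g0, mul_zero, sub_zero] at this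
      simpa using this
    · refine tendsto_atBot_mono' _ ?_ (tendsto_id.const_mul_atBot (inv_pos.2 hC))
      filter_upwards [eventually_le_atBot 0] with x hx
      have := hdiff hx
      simp only [g0, mul_zero, sub_zero] at this
      simpa using this
  let e := hmono.orderIsoOfSurjective g hsurj
  have he : ∀ z, g (e.symm z) = z := fun z => e.apply_symm_apply z
  refine ⟨e.symm, e.symm.continuous, hmono.injective (by rw [he, g0]), e.symm.injective,
    fun z => ?_⟩
  have := HasDerivAt.of_local_left_inverse (f := g) (g := e.symm) (a := z)
    e.symm.continuous.continuousAt (hd _) (inv_ne_zero (vpos _).ne') (Eventually.of_forall he)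
  simpa using this

/-- The slope of `X` is the slope of `X²` divided by `X y + X z`, so continuity of `X` suffices. -/
lemma hasDerivAt_of_sq_eq {X g : ℝ → ℝ} {z g' : ℝ} (hX : ContinuousAt X z) (hne : X z ≠ 0)
    (hg : HasDerivAt g g' z) (h : ∀ᶠ y in 𝓝 z, X y ^ 2 = g y) :
    HasDerivAt X (g' / (2 * X z)) z := by
  have hz := h.self_of_nhds
  rw [hasDerivAt_iff_tendsto_slope] at hg ⊢
  have hs : ContinuousAt (fun y => X y + X z) z := hX.add continuousAt_const
  have hs0 : X z + X z ≠ 0 := by simpa [← two_mul] using hne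
  have hlim := hg.div (hs.tendsto.mono_left (nhdsWithin_le_nhds (s := {z}ᶜ))) hs0
  rw [two_mul]
  refine hlim.congr' ?_
  filter_upwards [nhdsWithin_le_nhds h, nhdsWithin_le_nhds (hs.eventually_ne hs0)] with y hy hy0
  simp only [Pi.div_apply, slope_def_field, ← hy, ← hz]
  rw [div_div, mul_comm, ← div_div]
  congr 1
  field_simp
  ring

lemma hasDerivAt_of_eventually_ne {f g : ℝ → ℝ} {x : ℝ}
    (hd : ∀ᶠ y in 𝓝 x, y ≠ x → HasDerivAt f (g y) y) (hf : ContinuousAt f x)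
    (hg : ContinuousAt g x) : HasDerivAt f (g x) x := by
  obtain ⟨a, b, hx, hab⟩ := mem_nhds_iff_exists_Ioo_subset.1 hd
  have A : HasDerivWithinAt f (g x) (Ici x) x := by
    have hd' : ∀ y ∈ Ioo x b, HasDerivAt f (g y) y := fun y hy =>
      hab ⟨hx.1.trans hy.1, hy.2⟩ hy.1.ne'
    refine hasDerivWithinAt_Ici_of_tendsto_deriv (s := Ioo x b)
      (fun y hy => (hd' y hy).differentiableAt.differentiableWithinAt) hf.continuousWithinAt
      (Ioo_mem_nhdsGT hx.2) ?_
    refine (hg.tendsto.mono_left nhdsWithin_le_nhds).congr' ?_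
    filter_upwards [Ioo_mem_nhdsGT hx.2] with y hy using (hd' y hy).deriv.symm
  have B : HasDerivWithinAt f (g x) (Iic x) x := by
    have hd' : ∀ y ∈ Ioo a x, HasDerivAt f (g y) y := fun y hy =>
      hab ⟨hy.1, hy.2.trans hx.2⟩ hy.2.ne
    refine hasDerivWithinAt_Iic_of_tendsto_deriv (s := Ioo a x)
      (fun y hy => (hd' y hy).differentiableAt.differentiableWithinAt) hf.continuousWithinAt
      (Ioo_mem_nhdsLT hx.1) ?_
    refine (hg.tendsto.mono_left nhdsWithin_le_nhds).congr' ?_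
    filter_upwards [Ioo_mem_nhdsLT hx.1] with y hy using (hd' y hy).deriv.symm
  simpa using B.union A

/-- The covector `(a, b)` on the plane. -/
noncomputable def covec (a b : ℝ) : ℝ × ℝ →L[ℝ] ℝ :=
  a • ContinuousLinearMap.fst ℝ ℝ ℝ + b • ContinuousLinearMap.snd ℝ ℝ ℝ

@[simp] lemma covec_apply (a b : ℝ) (v : ℝ × ℝ) : covec a b v = a * v.1 + b * v.2 := by
  simp [covec]

lemma hasFDerivAt_of_partial {g : ℝ → ℝ → ℝ} {a b : ℝ × ℝ → ℝ} {u : ℝ × ℝ}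
    (ha : ContinuousAt a u) (hb : ContinuousAt b u)
    (h1 : ∀ᶠ v in 𝓝 u, HasDerivAt (fun w => g w v.2) (a v) v.1)
    (h2 : ∀ᶠ v in 𝓝 u, HasDerivAt (fun z => g v.1 z) (b v) v.2) :
    HasFDerivAt (fun q : ℝ × ℝ => g q.1 q.2) (covec (a u) (b u)) u := by
  have := (hasStrictFDerivAt_uncurry_coprod (𝕜 := ℝ) (f := g) (u := u)
    (f₁ := fun w z => ContinuousLinearMap.toSpanSingleton ℝ (a (w, z)))
    (f₂ := fun w z => ContinuousLinearMap.toSpanSingleton ℝ (b (w, z)))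
    (h1.mono fun v hv => hv.hasFDerivAt) (h2.mono fun v hv => hv.hasFDerivAt)
    ((ContinuousLinearMap.toSpanSingletonCLE (𝕜 := ℝ) (E := ℝ)).continuous.continuousAt.comp ha)
    ((ContinuousLinearMap.toSpanSingletonCLE (𝕜 := ℝ) (E := ℝ)).continuous.continuousAt.comp
      hb)).hasFDerivAt
  refine this.congr_fderiv ?_
  ext <;> simp [Function.HasUncurry.uncurry]

/-! ### The local solution of the overdetermined system -/

/-- The square of `∂ψ/∂z` as a function of `w` and `x = ψ`. -/
noncomputable def energy (T k : ℝ → ℝ) (w x : ℝ) : ℝ :=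
  6 * w * x + x * T x + 6 * x * k x - 2 * w * (w + k x) ^ 2

/-- The derivative of `energy T k w x` in `x`. -/
noncomputable def energyDeriv (T k : ℝ → ℝ) (w x : ℝ) : ℝ :=
  6 * w + 2 * k x + 36 * x / T x - 12 * w * (w + k x) / T x

/-- `ψ` is a local solution near `(w, z) = (1, 0)` of the overdetermined system for the profile
`(T, k)`, with `χ = ∂ψ/∂z`. -/
structure IsLocalSolution (T k : ℝ → ℝ) (δ : ℝ) (ψ χ : ℝ × ℝ → ℝ) : Prop where
  center : ψ (1, 0) = 0
  nonneg : ∀ q ∈ Ioo (1 - δ) (1 + δ) ×ˢ Ioo (-δ) δ, 0 ≤ ψ q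
  lt : ∀ q ∈ Ioo (1 - δ) (1 + δ) ×ˢ Ioo (-δ) δ, ψ q < 1 / 100
  eq_center : ∀ q ∈ Ioo (1 - δ) (1 + δ) ×ˢ Ioo (-δ) δ, ψ q = 0 → q = (1, 0)
  sq_eq : ∀ q ∈ Ioo (1 - δ) (1 + δ) ×ˢ Ioo (-δ) δ, χ q ^ 2 = energy T k q.1 (ψ q)
  hasFDerivAt : ∀ q ∈ Ioo (1 - δ) (1 + δ) ×ˢ Ioo (-δ) δ,
    HasFDerivAt ψ (covec (q.1 + k (ψ q)) (χ q)) q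
  hasFDerivAt_deriv : ∀ q ∈ Ioo (1 - δ) (1 + δ) ×ˢ Ioo (-δ) δ,
    HasFDerivAt χ (covec (3 / T (ψ q) * χ q) (energyDeriv T k q.1 (ψ q) / 2)) q

namespace IsProfile

variable {T k : ℝ → ℝ}

lemma hasDerivAt_energy (h : IsProfile T k) {w x : ℝ → ℝ} {t a b : ℝ}
    (hx : x t ∈ Ioo (-1 / 100 : ℝ) (1 / 100)) (hw : HasDerivAt w a t) (hxd : HasDerivAt x b t) :
    HasDerivAt (fun s => energy T k (w s) (x s))
      ((6 * x t - 2 * (w t + k (x t)) ^ 2 - 4 * w t * (w t + k (x t))) * a +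
        energyDeriv T k (w t) (x t) * b) t := by
  have hT := (h.T_pos (x t)).ne'
  have h1 := (h.hasDerivAt_mul _ hx).comp t hxd
  have h2 := (h.hasDerivAt_k (x t)).comp t hxd
  have := ((((hw.const_mul 6).mul hxd).add h1).add ((hxd.const_mul 6).mul h2)).sub
    ((hw.const_mul 2).mul ((hw.add h2).pow 2))
  refine (this.congr_of_eventuallyEq (Eventually.of_forall fun s => ?_)).congr_deriv ?_
  · simp [energy, Function.comp]
  · simp only [energyDeriv, Function.comp, Pi.add_apply, Pi.pow_apply]
    field_simp
    ring

lemma continuous_energyDeriv (h : IsProfile T k) :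
    Continuous fun q : ℝ × ℝ => energyDeriv T k q.1 q.2 := by
  have h1 := h.continuous
  have h2 := h.continuous_k
  unfold energyDeriv
  refine Continuous.sub (Continuous.add (by fun_prop) (Continuous.div (by fun_prop) (by fun_prop)
    fun q => (h.T_pos _).ne')) (Continuous.div (by fun_prop) (by fun_prop)
    fun q => (h.T_pos _).ne')

/-- The speed of the square root of `ψ` along the axis `w = 1`. -/
lemma exists_axis_speed (h : IsProfile T k) : ∃ m : ℝ → ℝ, Continuous m ∧
    (∀ x, 1 ≤ m x) ∧ (∀ x, m x ≤ 9) ∧ ∀ᶠ x in 𝓝 0, energy T k 1 x = x * m x := by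
  obtain ⟨κ, hκ, -, hκs⟩ := h.exists_mean_slope
  have c1 := h.continuous
  have c2 := h.continuous_k
  have c3 : Continuous fun x => κ 0 x := hκ.comp (f := fun x : ℝ => (0, x)) (by fun_prop)
  set m : ℝ → ℝ := fun x => 6 + T x + 6 * k x - 2 * x * κ 0 x ^ 2 with hm
  have cm : Continuous m := by fun_prop
  refine ⟨fun x => max 1 (min 9 (m x)), continuous_const.max (continuous_const.min cm),
    fun x => le_max_left _ _, fun x => max_le (by norm_num) (min_le_left _ _), ?_⟩
  have hT0 := abs_le.1 (h.abs_sub_le 0)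
  have m0 : m 0 = T 0 := by simp [hm, h.k_zero]
  have e1 : ∀ᶠ x in 𝓝 0, 1 < m x :=
    cm.continuousAt.eventually (lt_mem_nhds (by rw [m0]; linarith [hT0.1]))
  have e2 : ∀ᶠ x in 𝓝 0, m x < 9 :=
    cm.continuousAt.eventually (gt_mem_nhds (by rw [m0]; linarith [hT0.2]))
  filter_upwards [e1, e2] with x h1 h2
  rw [min_eq_right h2.le, max_eq_right h1.le]
  have := hκs 0 x
  rw [h.k_zero] at this
  have hk : k x = x * κ 0 x - 1 := by linarith
  simp only [hm, energy, hk]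
  ring

/-- On the line `w = 1` the equation `ψ_z² = x m(x)`, `x = ψ`, is degenerate at `0` and has the
spurious solution `ψ = 0`. Writing `ψ = ρ²` turns it into `ρ' = √(m(ρ²)) / 2`, whose speed is
bounded away from `0`. The flow in `w` then carries these values off the line. -/
theorem exists_localSolution (h : IsProfile T k) :
    ∃ δ > 0, δ ≤ 1 / 4 ∧ ∃ ψ χ : ℝ × ℝ → ℝ, IsLocalSolution T k δ ψ χ := by
  obtain ⟨Φ, E, hΦ, hE, hΦ1, hE1, hEpos, hflow⟩ := h.exists_flow
  obtain ⟨m, cm, m1, m9, hm⟩ := h.exists_axis_speed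
  have csp : Continuous fun x => √(m (x ^ 2)) / 2 := by fun_prop
  obtain ⟨ρ, cρ, ρ0, ρinj, hρ⟩ := exists_solution_of_bounded_speed csp (c := 1 / 2) (C := 3 / 2)
    (by norm_num)
    (fun x => by
      have : 1 ≤ √(m (x ^ 2)) := Real.one_le_sqrt.2 (m1 _)
      linarith)
    (fun x => by
      have : √(m (x ^ 2)) ≤ 3 := Real.sqrt_le_iff.2 ⟨by norm_num, by linarith [m9 (x ^ 2)]⟩
      linarith)
  set ψ : ℝ → ℝ → ℝ := fun w z => Φ (ρ z ^ 2) w with hψ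
  set χ : ℝ → ℝ → ℝ := fun w z => E (ρ z ^ 2) w * (ρ z * √(m (ρ z ^ 2))) with hχ
  have cψ : Continuous fun q : ℝ × ℝ => ψ q.1 q.2 :=
    hΦ.comp (f := fun q : ℝ × ℝ => (ρ q.2 ^ 2, q.1)) (by fun_prop)
  have cχ : Continuous fun q : ℝ × ℝ => χ q.1 q.2 :=
    (hE.comp (f := fun q : ℝ × ℝ => (ρ q.2 ^ 2, q.1)) (by fun_prop)).mul (by fun_prop)
  have cED : Continuous fun q : ℝ × ℝ => energyDeriv T k q.1 (ψ q.1 q.2) :=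
    h.continuous_energyDeriv.comp (f := fun q : ℝ × ℝ => (q.1, ψ q.1 q.2))
      (continuous_fst.prodMk cψ)
  have ck := h.continuous_k
  have cT := h.continuous
  have ψ10 : ψ 1 0 = 0 := by
    have := hΦ1 0 (by constructor <;> norm_num)
    simpa [hψ, ρ0] using this
  obtain ⟨δ, δ0, δ4, hδ⟩ : ∃ δ > 0, δ ≤ 1 / 4 ∧ ∀ w ∈ Ioo (1 - δ) (1 + δ), ∀ z ∈ Ioo (-δ) δ,
      ρ z ^ 2 ∈ Ioo (-1 / 4 : ℝ) (1 / 4) ∧ energy T k 1 (ρ z ^ 2) = ρ z ^ 2 * m (ρ z ^ 2) ∧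
      ψ w z ∈ Ioo (-1 / 100 : ℝ) (1 / 100) ∧ 0 < 6 * (w + k (ψ w z)) + T (ψ w z) := by
    have cr : Tendsto (fun q : ℝ × ℝ => ρ q.2 ^ 2) (𝓝 (1, 0)) (𝓝 0) := by
      have : Continuous fun q : ℝ × ℝ => ρ q.2 ^ 2 := by fun_prop
      simpa [ρ0] using this.tendsto (1, 0)
    have e1 : ∀ᶠ q : ℝ × ℝ in 𝓝 (1, 0), ρ q.2 ^ 2 ∈ Ioo (-1 / 4 : ℝ) (1 / 4) :=
      cr.eventually (Ioo_mem_nhds (by norm_num) (by norm_num))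
    have e2 := cr.eventually hm
    have e3 : ∀ᶠ q : ℝ × ℝ in 𝓝 (1, 0), ψ q.1 q.2 ∈ Ioo (-1 / 100 : ℝ) (1 / 100) :=
      cψ.continuousAt.eventually (Ioo_mem_nhds (by simp only [ψ10]; norm_num)
        (by simp only [ψ10]; norm_num))
    have e4 : ∀ᶠ q : ℝ × ℝ in 𝓝 (1, 0), 0 < 6 * (q.1 + k (ψ q.1 q.2)) + T (ψ q.1 q.2) := by
      have c : Continuous fun q : ℝ × ℝ => 6 * (q.1 + k (ψ q.1 q.2)) + T (ψ q.1 q.2) := by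
        fun_prop
      refine c.continuousAt.eventually (lt_mem_nhds ?_)
      simp [ψ10, h.k_zero, h.T_pos]
    obtain ⟨ε, ε0, hε⟩ := Metric.eventually_nhds_iff.1 (e1.and (e2.and (e3.and e4)))
    refine ⟨min ε (1 / 4), by positivity, min_le_right _ _, fun w hw z hz => ?_⟩
    refine hε (y := (w, z)) ?_
    have := min_le_left ε (1 / 4)
    rw [Prod.dist_eq, Real.dist_eq, Real.dist_eq, max_lt_iff, abs_lt, abs_lt]
    exact ⟨⟨by linarith [hw.1], by linarith [hw.2]⟩, by linarith [hz.1], by linarith [hz.2]⟩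
  have hwI : ∀ {w}, w ∈ Ioo (1 - δ) (1 + δ) → w ∈ Ioo (3 / 4 : ℝ) (5 / 4) := fun hw =>
    ⟨by linarith [hw.1], by linarith [hw.2]⟩
  have dρ : ∀ z, HasDerivAt (fun z => ρ z ^ 2) (ρ z * √(m (ρ z ^ 2))) z := fun z => by
    refine ((hρ z).pow 2).congr_deriv ?_
    simp; ring
  have ψw : ∀ w ∈ Ioo (1 - δ) (1 + δ), ∀ z ∈ Ioo (-δ) δ,
      HasDerivAt (fun w => ψ w z) (w + k (ψ w z)) w := fun w hw z hz =>
    (hflow _ (hδ w hw z hz).1 w (hwI hw)).1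
  have ψz : ∀ w ∈ Ioo (1 - δ) (1 + δ), ∀ z ∈ Ioo (-δ) δ,
      HasDerivAt (fun z => ψ w z) (χ w z) z := fun w hw z hz =>
    HasDerivAt.comp (h₂ := fun s => Φ s w) z (hflow _ (hδ w hw z hz).1 w (hwI hw)).2.1 (dρ z)
  have χw : ∀ w ∈ Ioo (1 - δ) (1 + δ), ∀ z ∈ Ioo (-δ) δ,
      HasDerivAt (fun w => χ w z) (3 / T (ψ w z) * χ w z) w := fun w hw z hz =>
    ((hflow _ (hδ w hw z hz).1 w (hwI hw)).2.2.mul_const _).congr_deriv (by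
      simp only [hχ, hψ]; ring)
  have one_mem : (1 : ℝ) ∈ Ioo (1 - δ) (1 + δ) := ⟨by linarith, by linarith⟩
  have hsq : ∀ w ∈ Ioo (1 - δ) (1 + δ), ∀ z ∈ Ioo (-δ) δ, χ w z ^ 2 = energy T k w (ψ w z) := by
    intro w hw z hz
    have cq : Continuous fun v => 6 / T (ψ v z) :=
      continuous_const.div (cT.comp (cψ.comp (f := fun v : ℝ => (v, z)) (by fun_prop)))
        fun v => (h.T_pos _).ne'
    -- Compatibility: by the profile ODE the defect `χ² - energy` solves a homogeneous linear
    -- equation in `w`. It vanishes at `w = 1` by the choice of `ρ`, hence for all `w`.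
    have hdiff : ∀ v ∈ Ioo (1 - δ) (1 + δ),
        HasDerivAt (fun v => χ v z ^ 2 - energy T k v (ψ v z))
          (6 / T (ψ v z) * (χ v z ^ 2 - energy T k v (ψ v z))) v := by
      intro v hv
      have hT := (h.T_pos (ψ v z)).ne'
      have h1 := h.hasDerivAt_energy (w := fun v => v) (x := fun v => ψ v z)
        (hδ v hv z hz).2.2.1 (hasDerivAt_id v) (ψw v hv z hz)
      refine (((χw v hv z hz).pow 2).sub h1).congr_deriv ?_
      simp only [energyDeriv, energy]
      field_simp
      ring
    have := eq_mul_exp_of_hasDerivAt_mul (y := fun v => χ v z ^ 2 - energy T k v (ψ v z)) cq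
      one_mem hdiff hw
    have h0 : χ 1 z ^ 2 - energy T k 1 (ψ 1 z) = 0 := by
      obtain ⟨a1, a2, -⟩ := hδ 1 one_mem z hz
      simp only [hχ, hψ, hΦ1 _ a1, hE1, a2, one_mul, mul_pow]
      rw [Real.sq_sqrt (by linarith [m1 (ρ z ^ 2)])]
      ring
    simp only [h0, zero_mul] at this
    linarith
  have χ_eq : ∀ w z, χ w z = 0 → z = 0 := fun w z h0 => by
    have hs : 0 < √(m (ρ z ^ 2)) := Real.sqrt_pos.2 (by linarith [m1 (ρ z ^ 2)])
    have : ρ z = 0 := by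
      simpa [hχ, (hEpos _ _).ne', hs.ne'] using h0
    exact ρinj (this.trans ρ0.symm)
  have χz : ∀ w ∈ Ioo (1 - δ) (1 + δ), ∀ z ∈ Ioo (-δ) δ,
      HasDerivAt (fun z => χ w z) (energyDeriv T k w (ψ w z) / 2) z := by
    intro w hw
    have cs : Continuous fun z => χ w z := cχ.comp (f := fun z : ℝ => (w, z)) (by fun_prop)
    -- Differentiating `χ² = energy` in `z` requires dividing by `χ`, which vanishes only at `z =
    -- 0`; that value is recovered by continuity.
    have hne : ∀ z ∈ Ioo (-δ) δ, z ≠ 0 →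
        HasDerivAt (fun z => χ w z) (energyDeriv T k w (ψ w z) / 2) z := by
      intro z hz hz0
      have hX : χ w z ≠ 0 := fun h0 => hz0 (χ_eq w z h0)
      refine (hasDerivAt_of_sq_eq cs.continuousAt hX (h.hasDerivAt_energy (w := fun _ => w)
          (x := fun z => ψ w z) (hδ w hw z hz).2.2.1 (hasDerivAt_const z w) (ψz w hw z hz))
          ?_).congr_deriv ?_
      · filter_upwards [Ioo_mem_nhds hz.1 hz.2] with y hy using hsq w hw y hy
      · field_simp
        ring
    intro z hz
    refine hasDerivAt_of_eventually_ne (g := fun z => energyDeriv T k w (ψ w z) / 2)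
      (x := z) ?_ cs.continuousAt ?_
    · by_cases hz0 : z = 0
      · filter_upwards [Ioo_mem_nhds hz.1 hz.2] with y hy hyz
        exact hne y hy (by rwa [← hz0])
      · filter_upwards [Ioo_mem_nhds hz.1 hz.2, isOpen_ne.mem_nhds hz0] with y hy hy0 _
        exact hne y hy hy0
    · exact ((cED.comp (f := fun z : ℝ => (w, z)) (by fun_prop)).div_const 2).continuousAt
  have hnhds : ∀ q ∈ Ioo (1 - δ) (1 + δ) ×ˢ Ioo (-δ) δ,
      Ioo (1 - δ) (1 + δ) ×ˢ Ioo (-δ) δ ∈ 𝓝 q := fun q hq =>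
    (isOpen_Ioo.prod isOpen_Ioo).mem_nhds hq
  -- The energy relation rearranged: the right side is a sum of nonnegative terms and the factor of
  -- `ψ` is positive near the centre. So `ψ ≥ 0`, with equality only if `χ = 0` and `w = 1`.
  have hpos : ∀ q ∈ Ioo (1 - δ) (1 + δ) ×ˢ Ioo (-δ) δ,
      ψ q.1 q.2 * (6 * (q.1 + k (ψ q.1 q.2)) + T (ψ q.1 q.2)) =
        χ q.1 q.2 ^ 2 + 2 * q.1 * (q.1 + k (ψ q.1 q.2)) ^ 2 := fun q hq => by
    rw [hsq q.1 hq.1 q.2 hq.2, energy]; ring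
  have hw0 : ∀ q ∈ Ioo (1 - δ) (1 + δ) ×ˢ Ioo (-δ) δ, 0 < q.1 := fun q hq => by
    linarith [hq.1.1]
  refine ⟨δ, δ0, δ4, fun q => ψ q.1 q.2, fun q => χ q.1 q.2, ψ10, fun q hq => ?_,
    fun q hq => (hδ q.1 hq.1 q.2 hq.2).2.2.1.2, fun q hq h0 => ?_,
    fun q hq => hsq q.1 hq.1 q.2 hq.2, fun q hq => ?_, fun q hq => ?_⟩
  · have hw := hw0 q hq
    refine nonneg_of_mul_nonneg_left (b := 6 * (q.1 + k (ψ q.1 q.2)) + T (ψ q.1 q.2)) ?_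
      (hδ q.1 hq.1 q.2 hq.2).2.2.2
    rw [hpos q hq]
    positivity
  · have hw := hw0 q hq
    have hp := hpos q hq
    replace h0 : ψ q.1 q.2 = 0 := h0
    rw [h0, zero_mul, h.k_zero] at hp
    have a1 : 0 ≤ 2 * q.1 * (q.1 + -1) ^ 2 := by positivity
    have a2 : χ q.1 q.2 ^ 2 = 0 := by linarith [sq_nonneg (χ q.1 q.2)]
    have a3 : 2 * q.1 * (q.1 + -1) ^ 2 = 0 := by linarith
    have a4 : q.1 = 1 := by
      rcases mul_eq_zero.1 a3 with h1 | h1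
      · linarith
      · linarith [pow_eq_zero_iff (two_ne_zero) |>.1 h1]
    exact Prod.ext a4 (χ_eq _ _ (pow_eq_zero_iff (two_ne_zero) |>.1 a2))
  · refine hasFDerivAt_of_partial (g := ψ) (a := fun q => q.1 + k (ψ q.1 q.2))
      (b := fun q => χ q.1 q.2) (by fun_prop) cχ.continuousAt ?_ ?_
    · filter_upwards [hnhds q hq] with v hv using ψw v.1 hv.1 v.2 hv.2
    · filter_upwards [hnhds q hq] with v hv using ψz v.1 hv.1 v.2 hv.2
  · refine hasFDerivAt_of_partial (g := χ) (a := fun q => 3 / T (ψ q.1 q.2) * χ q.1 q.2)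
      (b := fun q => energyDeriv T k q.1 (ψ q.1 q.2) / 2)
      (((h.continuous_slope.comp cψ).mul cχ).continuousAt) (cED.div_const 2).continuousAt ?_ ?_
    · filter_upwards [hnhds q hq] with v hv using χw v.1 hv.1 v.2 hv.2
    · filter_upwards [hnhds q hq] with v hv using χz v.1 hv.1 v.2 hv.2

end IsProfile

/-! ### Swirl, and smoothness where `ψ > 0` -/

/-- The square of the angular momentum density, up to sign, as a function of `ψ`. -/
noncomputable def swirlSq (T k : ℝ → ℝ) (x : ℝ) : ℝ := -(x * T x + 6 * x * k x)

namespace IsProfile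

variable {T k : ℝ → ℝ}

/-- Near `0` one has `T + 6k ≈ 4 - 6 < 0`. -/
lemma swirlSq_pos (h : IsProfile T k) {x : ℝ} (hx : x ∈ Ioo (0 : ℝ) (1 / 100)) :
    0 < swirlSq T k x := by
  have h1 := (abs_le.1 (h.abs_sub_le x)).2
  have h2 := (abs_le.1 (h.abs_k_add_one_le x)).2
  rw [abs_of_pos hx.1] at h2
  have : T x + 6 * k x < 0 := by linarith [hx.2]
  have := mul_neg_of_pos_of_neg hx.1 this
  unfold swirlSq
  linarith

lemma contDiffOn_T (h : IsProfile T k) : ContDiffOn ℝ ∞ T (Ioo 0 (1 / 100)) :=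
  h.contDiffOn.fst

lemma contDiffOn_k (h : IsProfile T k) : ContDiffOn ℝ ∞ k (Ioo 0 (1 / 100)) :=
  h.contDiffOn.snd

lemma contDiffOn_sqrt_swirlSq (h : IsProfile T k) :
    ContDiffOn ℝ ∞ (fun x => √(swirlSq T k x)) (Ioo 0 (1 / 100)) := by
  have h1 := h.contDiffOn_T
  have h2 := h.contDiffOn_k
  refine ContDiffOn.sqrt ?_ fun x hx => (h.swirlSq_pos hx).ne'
  unfold swirlSq
  exact ((contDiffOn_id.mul h1).add ((contDiffOn_const.mul contDiffOn_id).mul h2)).neg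

end IsProfile

namespace IsLocalSolution

variable {T k : ℝ → ℝ} {δ : ℝ} {ψ χ : ℝ × ℝ → ℝ}

lemma continuousOn (hs : IsLocalSolution T k δ ψ χ) :
    ContinuousOn ψ (Ioo (1 - δ) (1 + δ) ×ˢ Ioo (-δ) δ) := fun q hq =>
  (hs.hasFDerivAt q hq).continuousAt.continuousWithinAt

lemma isOpen_pos (hs : IsLocalSolution T k δ ψ χ) :
    IsOpen {q | q ∈ Ioo (1 - δ) (1 + δ) ×ˢ Ioo (-δ) δ ∧ 0 < ψ q} :=
  hs.continuousOn.isOpen_inter_preimage (isOpen_Ioo.prod isOpen_Ioo) isOpen_Ioi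

/-- The gradients of `ψ` and `χ` are expressions in `w`, `ψ` and `χ` themselves, smooth while `ψ`
stays in the range where `T` and `k` are smooth. -/
lemma contDiffOn (h : IsProfile T k) (hs : IsLocalSolution T k δ ψ χ) :
    ContDiffOn ℝ ∞ (fun q => (ψ q, χ q))
      {q | q ∈ Ioo (1 - δ) (1 + δ) ×ˢ Ioo (-δ) δ ∧ 0 < ψ q} := by
  refine contDiffOn_of_hasFDerivAt_comp
    (H := fun y : (ℝ × ℝ) × (ℝ × ℝ) => (covec (y.1.1 + k y.2.1) y.2.2).prod
      (covec (3 / T y.2.1 * y.2.2) (energyDeriv T k y.1.1 y.2.1 / 2)))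
    (W := {y | y.2.1 ∈ Ioo 0 (1 / 100)}) hs.isOpen_pos ?_ ?_ ?_
  · have hk : ContDiffOn ℝ ∞ (fun y : (ℝ × ℝ) × (ℝ × ℝ) => k y.2.1)
        {y | y.2.1 ∈ Ioo 0 (1 / 100)} :=
      h.contDiffOn_k.comp (f := fun y : (ℝ × ℝ) × (ℝ × ℝ) => y.2.1) (by fun_prop) fun y hy => hy
    have hT : ContDiffOn ℝ ∞ (fun y : (ℝ × ℝ) × (ℝ × ℝ) => (T y.2.1)⁻¹)
        {y | y.2.1 ∈ Ioo 0 (1 / 100)} :=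
      (h.contDiffOn_T.comp (f := fun y : (ℝ × ℝ) × (ℝ × ℝ) => y.2.1) (by fun_prop)
        fun y hy => hy).inv fun y _ => (h.T_pos _).ne'
    have e : (fun y : (ℝ × ℝ) × (ℝ × ℝ) => (covec (y.1.1 + k y.2.1) y.2.2).prod
        (covec (3 / T y.2.1 * y.2.2) (energyDeriv T k y.1.1 y.2.1 / 2))) =
        fun y => (y.1.1 + k y.2.1) • (covec 1 0).prod (covec 0 0) +
          y.2.2 • (covec 0 1).prod (covec 0 0) +
          (3 * (T y.2.1)⁻¹ * y.2.2) • (covec 0 0).prod (covec 1 0) +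
          ((6 * y.1.1 + 2 * k y.2.1 + 36 * y.2.1 * (T y.2.1)⁻¹ -
            12 * y.1.1 * (y.1.1 + k y.2.1) * (T y.2.1)⁻¹) / 2) •
            (covec 0 0).prod (covec 0 1) := by
      funext y
      ext <;> simp [energyDeriv, div_eq_mul_inv]
    have key : ∀ (a b : (ℝ × ℝ) × (ℝ × ℝ) → ℝ) (s : Set ((ℝ × ℝ) × (ℝ × ℝ))),
        ContDiffOn ℝ ∞ a s → ContDiffOn ℝ ∞ b s → ContDiffOn ℝ ∞ (fun y =>
          (y.1.1 + a y) • (covec 1 0).prod (covec 0 0) +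
          y.2.2 • (covec 0 1).prod (covec 0 0) +
          (3 * b y * y.2.2) • (covec 0 0).prod (covec 1 0) +
          ((6 * y.1.1 + 2 * a y + 36 * y.2.1 * b y -
            12 * y.1.1 * (y.1.1 + a y) * b y) / 2) • (covec 0 0).prod (covec 0 1)) s := by
      intro a b s ha hb
      fun_prop
    rw [e]
    exact key _ _ _ hk hT
  · exact fun q hq => ⟨hq.2, hs.lt q hq.1⟩
  · exact fun q hq => (hs.hasFDerivAt q hq.1).prodMk (hs.hasFDerivAt_deriv q hq.1)

end IsLocalSolution

/-! ### Axisymmetric Euler equations and localization -/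

/-- The steady Euler equations for the axially symmetric velocity
`(x₁ M - x₂ N, x₂ M + x₁ N, Q)` and the pressure `p`, all of which are functions of
`w = (x₁² + x₂²) / 2` and `z = x₃`. -/
structure IsAxisymSolutionAt (M N Q p : ℝ × ℝ → ℝ) (q : ℝ × ℝ) : Prop where
  incompressible : 2 * M q + 2 * q.1 * fderiv ℝ M q (1, 0) + fderiv ℝ Q q (0, 1) = 0
  radial : M q ^ 2 - N q ^ 2 + (2 * q.1 * M q * fderiv ℝ M q (1, 0) + Q q * fderiv ℝ M q (0, 1)) +
    fderiv ℝ p q (1, 0) = 0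
  swirl : 2 * M q * N q + (2 * q.1 * M q * fderiv ℝ N q (1, 0) + Q q * fderiv ℝ N q (0, 1)) = 0
  axial : 2 * q.1 * M q * fderiv ℝ Q q (1, 0) + Q q * fderiv ℝ Q q (0, 1) +
    fderiv ℝ p q (0, 1) = 0

lemma isAxisymSolutionAt_of_eventually_const {M N Q p : ℝ × ℝ → ℝ} {q : ℝ × ℝ} {c : ℝ}
    (hM : M =ᶠ[𝓝 q] fun _ => 0) (hN : N =ᶠ[𝓝 q] fun _ => 0) (hQ : Q =ᶠ[𝓝 q] fun _ => 0)
    (hp : p =ᶠ[𝓝 q] fun _ => c) : IsAxisymSolutionAt M N Q p q := by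
  constructor <;>
    simp [hM.fderiv_eq, hN.fderiv_eq, hQ.fderiv_eq, hp.fderiv_eq, hM.eq_of_nhds, hN.eq_of_nhds,
      hQ.eq_of_nhds]

lemma isAxisymSolutionAt_of_eventuallyEq {M N Q p M' N' Q' p' : ℝ × ℝ → ℝ} {q : ℝ × ℝ}
    (hM : M =ᶠ[𝓝 q] M') (hN : N =ᶠ[𝓝 q] N') (hQ : Q =ᶠ[𝓝 q] Q') (hp : p =ᶠ[𝓝 q] p')
    (h : IsAxisymSolutionAt M' N' Q' p' q) : IsAxisymSolutionAt M N Q p q := by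
  obtain ⟨h1, h2, h3, h4⟩ := h
  constructor <;>
    rw [hM.eq_of_nhds] <;>
    simpa only [hM.fderiv_eq, hN.fderiv_eq, hQ.fderiv_eq, hp.fderiv_eq, hM.eq_of_nhds,
      hN.eq_of_nhds, hQ.eq_of_nhds]

/-- Localizability: the velocity of a local solution can be multiplied by any function of `ψ`. -/
lemma IsLocalSolution.isAxisymSolutionAt {T k : ℝ → ℝ} {δ : ℝ} {ψ χ : ℝ × ℝ → ℝ}
    (h : IsProfile T k) (hs : IsLocalSolution T k δ ψ χ) {φ P : ℝ → ℝ} {q : ℝ × ℝ}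
    (hφ : Differentiable ℝ φ) (hP : ∀ x, HasDerivAt P (φ x ^ 2) x)
    (hq : q ∈ Ioo (1 - δ) (1 + δ) ×ˢ Ioo (-δ) δ) (hw : 0 < q.1) (hpos : 0 < ψ q) :
    IsAxisymSolutionAt (fun q => φ (ψ q) * χ q * (2 * q.1)⁻¹)
      (fun q => φ (ψ q) * √(swirlSq T k (ψ q)) * (2 * q.1)⁻¹)
      (fun q => -(φ (ψ q) * (q.1 + k (ψ q)))) (fun q => P (ψ q)) q := by
  have hx : ψ q ∈ Ioo (0 : ℝ) (1 / 100) := ⟨hpos, hs.lt q hq⟩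
  have hF := h.swirlSq_pos hx
  have hT := (h.T_pos (ψ q)).ne'
  have dψ := hs.hasFDerivAt q hq
  have dχ := hs.hasFDerivAt_deriv q hq
  have d1 := (hφ (ψ q)).hasDerivAt.comp_hasFDerivAt q dψ
  have dk := (h.hasDerivAt_k (ψ q)).comp_hasFDerivAt q dψ
  have dP := (hP (ψ q)).comp_hasFDerivAt q dψ
  -- The value of `F'` is irrelevant: `r u_θ` is a function of `ψ`, so it is transported by the flow
  -- and `F'` cancels from the swirl equation.
  obtain ⟨F', hF'⟩ : ∃ F', HasDerivAt (fun x => √(swirlSq T k x)) F' (ψ q) :=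
    ⟨_, ((h.contDiffOn_sqrt_swirlSq.contDiffAt (Ioo_mem_nhds hx.1 hx.2)).differentiableAt
      (by simp)).hasDerivAt⟩
  have dF := hF'.comp_hasFDerivAt q dψ
  have dw : HasFDerivAt (fun q : ℝ × ℝ => q.1) (covec 1 0) q :=
    hasFDerivAt_fst.congr_fderiv (by ext <;> simp)
  have di : HasFDerivAt (fun q : ℝ × ℝ => (2 * q.1)⁻¹)
      ((-2 / (2 * q.1) ^ 2) • covec 1 0) q := by
    have : HasDerivAt (fun w : ℝ => (2 * w)⁻¹) (-2 / (2 * q.1) ^ 2) q.1 := by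
      exact (((hasDerivAt_id q.1).const_mul 2).inv (by simpa using hw.ne')).congr_deriv (by simp)
    exact this.comp_hasFDerivAt q dw
  have eM := ((d1.mul dχ).mul di).fderiv
  have eN := ((d1.mul dF).mul di).fderiv
  have eQ := (d1.mul (dw.add dk)).neg.fderiv
  have eP := dP.fderiv
  have hsq := hs.sq_eq q hq
  have hF2 := Real.sq_sqrt hF.le
  rw [show swirlSq T k (ψ q) = -(ψ q * T (ψ q) + 6 * ψ q * k (ψ q)) from rfl] at hF2
  simp only [energy] at hsq
  have hw' := hw.ne'
  constructor
  · erw [eM, eQ]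
    simp
    field_simp
    ring
  · erw [eM, eP]
    simp [energyDeriv]
    rw [show √(swirlSq T k (ψ q)) = √(-(ψ q * T (ψ q) + 6 * ψ q * k (ψ q))) from rfl]
    generalize √(-(ψ q * T (ψ q) + 6 * ψ q * k (ψ q))) = F at hF2 ⊢
    field_simp
    linear_combination (φ (ψ q)) ^ 2 * (6 * q.1 - T (ψ q)) * hsq - (φ (ψ q)) ^ 2 * T (ψ q) * hF2
  · erw [eN]
    simp
    field_simp
    ring
  · erw [eQ, eP]
    simp
    field_simp
    ring

/-! ### Cut-off and extension to the whole meridian plane -/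

/-- A smooth function on the line supported in `(c / 4, c / 2)`, with a primitive of its square
that is constant off that interval. -/
lemma exists_cutoff {c : ℝ} (hc : 0 < c) : ∃ φ P : ℝ → ℝ, ContDiff ℝ ∞ φ ∧ ContDiff ℝ ∞ P ∧
    (∀ x, HasDerivAt P (φ x ^ 2) x) ∧ (∀ x, x < c / 4 → φ x = 0) ∧ (∀ x, c / 2 < x → φ x = 0) ∧
    0 < φ (3 * c / 8) ∧ (∀ x, x < c / 4 → P x = P (c / 4)) ∧ ∀ x, c / 2 < x → P x = 0 := by
  let φ : ContDiffBump (3 * c / 8) := ⟨c / 16, c / 8, by linarith, by linarith⟩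
  have hr : φ.rOut = c / 8 := rfl
  have h1 : ∀ x, x ≤ c / 4 → φ x = 0 := fun x hx => φ.zero_of_le_dist (by
    rw [hr, Real.dist_eq, abs_sub_comm]
    exact le_trans (by linarith) (le_abs_self _))
  have h2 : ∀ x, c / 2 ≤ x → φ x = 0 := fun x hx => φ.zero_of_le_dist (by
    rw [hr, Real.dist_eq]
    exact le_trans (by linarith) (le_abs_self _))
  have hφ : ContDiff ℝ ∞ φ := φ.contDiff
  -- Integrating from `c`, beyond the support of `φ`, makes the primitive vanish on the outer side,
  -- which matches the later extension by zero.
  have hd : ∀ x, HasDerivAt (fun x => ∫ s in c..x, φ s ^ 2) (φ x ^ 2) x :=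
    hasDerivAt_primitive (φ.continuous.pow 2) c
  refine ⟨φ, fun x => ∫ s in c..x, φ s ^ 2, hφ, ?_, hd, fun x hx => h1 x hx.le,
    fun x hx => h2 x hx.le, φ.pos_of_mem_ball ?_, fun x hx => ?_, fun x hx => ?_⟩
  · rw [contDiff_infty_iff_deriv]
    refine ⟨fun x => (hd x).differentiableAt, ?_⟩
    rw [show deriv (fun x => ∫ s in c..x, φ s ^ 2) = fun x => φ x ^ 2 from
      funext fun x => (hd x).deriv]
    exact hφ.pow 2
  · rw [hr, Metric.mem_ball, dist_self]; linarith
  · have ci : Continuous fun s => φ s ^ 2 := φ.continuous.pow 2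
    beta_reduce
    rw [← sub_eq_zero, intervalIntegral.integral_interval_sub_left
      (ci.intervalIntegrable _ _) (ci.intervalIntegrable _ _)]
    refine intervalIntegral.integral_zero_ae (Eventually.of_forall fun s hs => ?_)
    rw [uIoc_of_ge hx.le] at hs
    simp [h1 s hs.2]
  · refine intervalIntegral.integral_zero_ae (Eventually.of_forall fun s hs => ?_)
    have : c / 2 ≤ s := by
      rcases le_total c x with h | h
      · rw [uIoc_of_le h] at hs; linarith [hs.1]
      · rw [uIoc_of_ge h] at hs; linarith [hs.1]
    simp [h2 s this]

/-- The centre is the only zero of `ψ`, so `ψ ≥ c > 0` near the edge of a small rectangle `K`. The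
band `c/4 ≤ ψ ≤ c/2` in `K` then avoids both the edge and the centre, and extending by zero outside
`K` is smooth. -/
theorem exists_meridional_solution : ∃ (M N Q p : ℝ × ℝ → ℝ) (A : Set (ℝ × ℝ)),
    ContDiff ℝ ∞ M ∧ ContDiff ℝ ∞ N ∧ ContDiff ℝ ∞ Q ∧ ContDiff ℝ ∞ p ∧
    IsCompact A ∧ A ⊆ Icc (3 / 4) (5 / 4) ×ˢ Icc (-1 / 4) (1 / 4) ∧ (1, 0) ∉ A ∧
    (∀ q ∉ A, M q = 0 ∧ N q = 0 ∧ Q q = 0) ∧ (∃ q ∈ A, N q ≠ 0) ∧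
    ∀ q, IsAxisymSolutionAt M N Q p q := by
  obtain ⟨T, k, a1, a2, a3, a4, a5⟩ := exists_profile
  have h : IsProfile T k := ⟨a1, a2, a3, a4, a5⟩
  obtain ⟨δ, δ0, δ4, ψ, χ, hs⟩ := h.exists_localSolution
  set U := Ioo (1 - δ) (1 + δ) ×ˢ Ioo (-δ) δ with hU
  set K := Icc (1 - δ / 2) (1 + δ / 2) ×ˢ Icc (-(δ / 2)) (δ / 2) with hK
  set K' := Ioo (1 - δ / 2) (1 + δ / 2) ×ˢ Ioo (-(δ / 2)) (δ / 2) with hK'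
  have oU : IsOpen U := isOpen_Ioo.prod isOpen_Ioo
  have oK' : IsOpen K' := isOpen_Ioo.prod isOpen_Ioo
  have cK : IsCompact K := isCompact_Icc.prod isCompact_Icc
  have KU : K ⊆ U := prod_mono (Icc_subset_Ioo (by linarith) (by linarith))
    (Icc_subset_Ioo (by linarith) (by linarith))
  have K'K : K' ⊆ K := prod_mono Ioo_subset_Icc_self Ioo_subset_Icc_self
  have cψ : ContinuousOn ψ K := hs.continuousOn.mono KU
  have center_mem : ((1, 0) : ℝ × ℝ) ∈ K' :=
    ⟨⟨by linarith, by linarith⟩, by linarith, by linarith⟩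
  have side_mem : ((1 + δ / 2, 0) : ℝ × ℝ) ∈ K \ K' :=
    ⟨⟨⟨by linarith, le_rfl⟩, by linarith, by linarith⟩, fun hh => lt_irrefl _ hh.1.2⟩
  obtain ⟨b, hbK, hb⟩ := (cK.diff oK').exists_isMinOn ⟨_, side_mem⟩ (cψ.mono sdiff_subset)
  set c := ψ b with hc
  have c0 : 0 < c := by
    refine lt_of_le_of_ne (hs.nonneg b (KU hbK.1)) fun h0 => hbK.2 ?_
    rw [hs.eq_center b (KU hbK.1) h0.symm]
    exact center_mem
  have hbd : ∀ q ∈ K, ψ q < c → q ∈ K' := fun q hq hlt => by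
    by_contra hn
    exact absurd (hb ⟨hq, hn⟩) (not_le.2 hlt)
  obtain ⟨φ, P, sφ, sP, hP, φl, φr, φpos, Pl, Pr⟩ := exists_cutoff c0
  set A := {q | q ∈ K ∧ ψ q ∈ Icc (c / 4) (c / 2)} with hA
  have clA : IsClosed A := cψ.preimage_isClosed_of_isClosed cK.isClosed isClosed_Icc
  have cA : IsCompact A := cK.of_isClosed_subset clA fun q hq => hq.1
  have AK' : ∀ q ∈ A, q ∈ K' := fun q hq => hbd q hq.1 (by linarith [hq.2.2])
  have φzero : ∀ q ∈ K, q ∉ A → φ (ψ q) = 0 := fun q hq hqA => by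
    by_cases h1 : ψ q < c / 4
    · exact φl _ h1
    · exact φr _ (not_le.1 fun h2 => hqA ⟨hq, not_lt.1 h1, h2⟩)
  set V := {q | q ∈ U ∧ 0 < ψ q} with hV
  have oV : IsOpen V := hs.isOpen_pos
  have AV : ∀ q ∈ A, q ∈ V := fun q hq => ⟨KU hq.1, by linarith [hq.2.1]⟩
  have near : ∀ (g : ℝ × ℝ → ℝ), ∀ q ∈ A, K.indicator g =ᶠ[𝓝 q] g := fun g q hq => by
    filter_upwards [oK'.mem_nhds (AK' q hq)] with y hy using indicator_of_mem (K'K hy) g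
  have far : ∀ (g : ℝ × ℝ → ℝ), (∀ y, φ (ψ y) = 0 → g y = 0) → ∀ q ∉ A,
      K.indicator g =ᶠ[𝓝 q] fun _ => 0 := fun g hg q hq => by
    filter_upwards [clA.isOpen_compl.mem_nhds hq] with y hy
    by_cases hyK : y ∈ K
    · rw [indicator_of_mem hyK]; exact hg y (φzero y hyK hy)
    · exact indicator_of_notMem hyK g
  have smooth : ∀ (g : ℝ × ℝ → ℝ), (∀ y, φ (ψ y) = 0 → g y = 0) → ContDiffOn ℝ ∞ g V →
      ContDiff ℝ ∞ (K.indicator g) := fun g hg hgV => by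
    refine contDiff_iff_contDiffAt.2 fun q => ?_
    by_cases hq : q ∈ A
    · exact (hgV.contDiffAt (oV.mem_nhds (AV q hq))).congr_of_eventuallyEq (near g q hq)
    · exact contDiffAt_const.congr_of_eventuallyEq (far g hg q hq)
  -- Unlike the velocity, the pressure has two plateaus off the band: `P (c / 4)` around the centre
  -- and `0` outside.
  have farP : ∀ q ∉ A, ∃ C, K.indicator (fun q => P (ψ q)) =ᶠ[𝓝 q] fun _ => C := by
    intro q hq
    by_cases hqK : q ∈ K
    · have hct := (hs.hasFDerivAt q (KU hqK)).continuousAt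
      rcases lt_or_ge (ψ q) (c / 4) with h1 | h1
      · refine ⟨P (c / 4), ?_⟩
        filter_upwards [oK'.mem_nhds (hbd q hqK (by linarith)), hct.eventually (gt_mem_nhds h1)]
          with y hy hy1
        rw [indicator_of_mem (K'K hy), Pl _ hy1]
      · have h2 : c / 2 < ψ q := not_le.1 fun h2 => hq ⟨hqK, h1, h2⟩
        refine ⟨0, ?_⟩
        filter_upwards [hct.eventually (lt_mem_nhds h2)] with y hy
        by_cases hyK : y ∈ K
        · rw [indicator_of_mem hyK, Pr _ hy]
        · exact indicator_of_notMem hyK _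
    · refine ⟨0, ?_⟩
      filter_upwards [cK.isClosed.isOpen_compl.mem_nhds hqK] with y hy
      exact indicator_of_notMem hy _
  have sψ : ContDiffOn ℝ ∞ ψ V := (hs.contDiffOn h).fst
  have sχ : ContDiffOn ℝ ∞ χ V := (hs.contDiffOn h).snd
  have maps : MapsTo ψ V (Ioo 0 (1 / 100)) := fun q hq => ⟨hq.2, hs.lt q hq.1⟩
  have sφψ : ContDiffOn ℝ ∞ (fun q => φ (ψ q)) V := sφ.comp_contDiffOn sψ
  have sF : ContDiffOn ℝ ∞ (fun q => √(swirlSq T k (ψ q))) V :=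
    h.contDiffOn_sqrt_swirlSq.comp sψ maps
  have sk : ContDiffOn ℝ ∞ (fun q => k (ψ q)) V := h.contDiffOn_k.comp sψ maps
  have wpos : ∀ q ∈ U, 0 < q.1 := fun q hq => by linarith [hq.1.1]
  have si : ContDiffOn ℝ ∞ (fun q : ℝ × ℝ => (2 * q.1)⁻¹) V :=
    ContDiffOn.inv (by fun_prop) fun q hq => by
      have := wpos q hq.1
      positivity
  refine ⟨K.indicator fun q => φ (ψ q) * χ q * (2 * q.1)⁻¹,
    K.indicator fun q => φ (ψ q) * √(swirlSq T k (ψ q)) * (2 * q.1)⁻¹,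
    K.indicator fun q => -(φ (ψ q) * (q.1 + k (ψ q))),
    K.indicator fun q => P (ψ q), A,
    smooth _ (fun y hy => by simp [hy]) ((sφψ.mul sχ).mul si),
    smooth _ (fun y hy => by simp [hy]) ((sφψ.mul sF).mul si),
    smooth _ (fun y hy => by simp [hy]) (sφψ.mul (contDiffOn_fst.add sk)).neg, ?_, cA,
    fun q hq => ⟨⟨by linarith [hq.1.1.1], by linarith [hq.1.1.2]⟩,
      by linarith [hq.1.2.1], by linarith [hq.1.2.2]⟩, fun hq => ?_, fun q hq =>
    ⟨(far _ (fun y hy => by simp [hy]) q hq).eq_of_nhds,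
      (far _ (fun y hy => by simp [hy]) q hq).eq_of_nhds,
      (far _ (fun y hy => by simp [hy]) q hq).eq_of_nhds⟩, ?_, fun q => ?_⟩
  · refine contDiff_iff_contDiffAt.2 fun q => ?_
    by_cases hq : q ∈ A
    · exact ((sP.comp_contDiffOn sψ).contDiffAt (oV.mem_nhds (AV q hq))).congr_of_eventuallyEq
        (near _ q hq)
    · obtain ⟨C, hC⟩ := farP q hq
      exact contDiffAt_const.congr_of_eventuallyEq hC
  · have := hq.2.1
    rw [hs.center] at this
    linarith
  · have pre : IsPreconnected K := isPreconnected_Icc.prod isPreconnected_Icc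
    have hle : c ≤ ψ (1 + δ / 2, 0) := hb side_mem
    -- Nontriviality: `ψ` takes the value `3c/8`, the middle of the band, where both `φ` and the
    -- swirl are positive.
    obtain ⟨q, hq, hval⟩ := pre.intermediate_value (K'K center_mem) side_mem.1 cψ
      (show 3 * c / 8 ∈ Icc _ _ from ⟨by rw [hs.center]; linarith, by linarith⟩)
    have hqA : q ∈ A := ⟨hq, by rw [hval]; constructor <;> linarith⟩
    refine ⟨q, hqA, ?_⟩
    have h1 := wpos q (KU hq)
    have h2 := h.swirlSq_pos (maps (AV q hqA))
    rw [indicator_of_mem hq, hval]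
    rw [hval] at h2
    positivity
  · by_cases hq : q ∈ A
    · exact isAxisymSolutionAt_of_eventuallyEq (near _ q hq) (near _ q hq) (near _ q hq)
        (near _ q hq) (hs.isAxisymSolutionAt h (sφ.differentiable (by simp)) hP (AV q hq).1
          (wpos q (AV q hq).1) (AV q hq).2)
    · obtain ⟨C, hC⟩ := farP q hq
      exact isAxisymSolutionAt_of_eventually_const (far _ (fun y hy => by simp [hy]) q hq)
        (far _ (fun y hy => by simp [hy]) q hq) (far _ (fun y hy => by simp [hy]) q hq) hC

/-! ### From the meridian plane to space -/

open Euler3D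

/-- The meridional coordinates `(w, z)` of a point. -/
noncomputable def meridian (x : Space) : ℝ × ℝ := ((x 0 ^ 2 + x 1 ^ 2) / 2, x 2)

/-- The axially symmetric vector field `(x₁ M - x₂ N, x₂ M + x₁ N, Q)`. -/
noncomputable def axisymField (M N Q : ℝ × ℝ → ℝ) (x : Space) : Space :=
  (x 0 * M (meridian x) - x 1 * N (meridian x)) • EuclideanSpace.single 0 1 +
    (x 1 * M (meridian x) + x 0 * N (meridian x)) • EuclideanSpace.single 1 1 +
    Q (meridian x) • EuclideanSpace.single 2 1

lemma contDiff_coord (i : Fin 3) : ContDiff ℝ ∞ fun x : Space => x i :=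
  (EuclideanSpace.proj i : Space →L[ℝ] ℝ).contDiff

lemma contDiff_meridian : ContDiff ℝ ∞ meridian := by
  have h0 := contDiff_coord 0
  have h1 := contDiff_coord 1
  exact (((h0.pow 2).add (h1.pow 2)).div_const 2).prodMk (contDiff_coord 2)

lemma contDiff_axisymField {M N Q : ℝ × ℝ → ℝ} (hM : ContDiff ℝ ∞ M) (hN : ContDiff ℝ ∞ N)
    (hQ : ContDiff ℝ ∞ Q) : ContDiff ℝ ∞ (axisymField M N Q) := by
  have h0 := contDiff_coord 0
  have h1 := contDiff_coord 1
  have hM' := hM.comp contDiff_meridian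
  have hN' := hN.comp contDiff_meridian
  have hQ' := hQ.comp contDiff_meridian
  exact ((((h0.mul hM').sub (h1.mul hN')).smul contDiff_const).add
    (((h1.mul hM').add (h0.mul hN')).smul contDiff_const)).add (hQ'.smul contDiff_const)

/-- The differential of `meridian`. -/
noncomputable def meridianDeriv (x : Space) : Space →L[ℝ] ℝ × ℝ :=
  (x 0 • EuclideanSpace.proj 0 + x 1 • EuclideanSpace.proj 1 : Space →L[ℝ] ℝ).prod
    (EuclideanSpace.proj 2)

lemma hasFDerivAt_coord (i : Fin 3) (x : Space) :
    HasFDerivAt (fun x : Space => x i) (EuclideanSpace.proj i : Space →L[ℝ] ℝ) x :=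
  (EuclideanSpace.proj i : Space →L[ℝ] ℝ).hasFDerivAt

lemma hasFDerivAt_meridian (x : Space) : HasFDerivAt meridian (meridianDeriv x) x := by
  have := (((hasFDerivAt_coord 0 x).pow 2).add ((hasFDerivAt_coord 1 x).pow 2)).mul_const
    (2⁻¹ : ℝ)
  refine (HasFDerivAt.prodMk this (hasFDerivAt_coord 2 x)).congr_fderiv ?_
  ext v <;> simp [meridianDeriv]
  ring

lemma hasFDerivAt_comp_meridian {g : ℝ × ℝ → ℝ} (hg : Differentiable ℝ g) (x : Space) :
    HasFDerivAt (fun x => g (meridian x)) ((covec (fderiv ℝ g (meridian x) (1, 0))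
      (fderiv ℝ g (meridian x) (0, 1))).comp (meridianDeriv x)) x := by
  have e : fderiv ℝ g (meridian x) = covec (fderiv ℝ g (meridian x) (1, 0))
      (fderiv ℝ g (meridian x) (0, 1)) := by
    ext <;> simp
  rw [← e]
  exact (hg _).hasFDerivAt.comp x (hasFDerivAt_meridian x)

lemma gradient_apply (p : Space → ℝ) (x : Space) (i : Fin 3) :
    gradient p x i = fderiv ℝ p x (EuclideanSpace.single i 1) := by
  rw [← InnerProductSpace.toDual_symm_apply (𝕜 := ℝ), real_inner_comm,
    EuclideanSpace.inner_single_left]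
  simp [gradient]

/-- The existential only names the directional derivatives of the three coefficients; users
eliminate it with `rfl`. -/
lemma fderiv_axisymField {M N Q : ℝ × ℝ → ℝ} (hM : Differentiable ℝ M) (hN : Differentiable ℝ N)
    (hQ : Differentiable ℝ Q) (x v : Space) :
    ∃ dM dN dQ : ℝ,
      dM = (x 0 * v 0 + x 1 * v 1) * fderiv ℝ M (meridian x) (1, 0) +
        v 2 * fderiv ℝ M (meridian x) (0, 1) ∧
      dN = (x 0 * v 0 + x 1 * v 1) * fderiv ℝ N (meridian x) (1, 0) +
        v 2 * fderiv ℝ N (meridian x) (0, 1) ∧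
      dQ = (x 0 * v 0 + x 1 * v 1) * fderiv ℝ Q (meridian x) (1, 0) +
        v 2 * fderiv ℝ Q (meridian x) (0, 1) ∧
      fderiv ℝ (axisymField M N Q) x v =
        (v 0 * M (meridian x) + x 0 * dM - (v 1 * N (meridian x) + x 1 * dN)) •
          EuclideanSpace.single 0 1 +
        (v 1 * M (meridian x) + x 1 * dM + (v 0 * N (meridian x) + x 0 * dN)) •
          EuclideanSpace.single 1 1 + dQ • EuclideanSpace.single 2 1 := by
  refine ⟨_, _, _, rfl, rfl, rfl, ?_⟩
  have h0 := hasFDerivAt_coord 0 x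
  have h1 := hasFDerivAt_coord 1 x
  have dM := hasFDerivAt_comp_meridian hM x
  have dN := hasFDerivAt_comp_meridian hN x
  have dQ := hasFDerivAt_comp_meridian hQ x
  have := ((((h0.mul dM).sub (h1.mul dN)).smul_const (EuclideanSpace.single (0 : Fin 3) (1 : ℝ))).add
    (((h1.mul dM).add (h0.mul dN)).smul_const (EuclideanSpace.single (1 : Fin 3) (1 : ℝ)))).add
    (dQ.smul_const (EuclideanSpace.single (2 : Fin 3) (1 : ℝ)))
  rw [show fderiv ℝ (axisymField M N Q) x = _ from this.fderiv]
  ext i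
  fin_cases i <;> simp [meridianDeriv] <;> ring

lemma divergence_axisymField {M N Q p : ℝ × ℝ → ℝ} (hM : Differentiable ℝ M)
    (hN : Differentiable ℝ N) (hQ : Differentiable ℝ Q) {x : Space}
    (h : IsAxisymSolutionAt M N Q p (meridian x)) :
    divergence (axisymField M N Q) x = 0 := by
  have e := h.incompressible
  unfold divergence
  rw [Fin.sum_univ_three]
  obtain ⟨_, _, _, rfl, rfl, rfl, e0⟩ :=
    fderiv_axisymField hM hN hQ x (EuclideanSpace.single 0 1)
  obtain ⟨_, _, _, rfl, rfl, rfl, e1⟩ :=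
    fderiv_axisymField hM hN hQ x (EuclideanSpace.single 1 1)
  obtain ⟨_, _, _, rfl, rfl, rfl, e2⟩ :=
    fderiv_axisymField hM hN hQ x (EuclideanSpace.single 2 1)
  rw [e0, e1, e2]
  have hm : (meridian x).1 = (x 0 ^ 2 + x 1 ^ 2) / 2 := rfl
  rw [hm] at e
  simp
  linear_combination e

lemma convect_eq_fderiv (v w : Space → Space) (x : Space) :
    convect v w x = fderiv ℝ w x (v x) := by
  unfold convect
  simp_rw [← map_smul, ← map_sum]
  congr 1
  ext j
  simp [Fin.sum_univ_three]
  fin_cases j <;> simp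

lemma momentum_axisymField {M N Q p : ℝ × ℝ → ℝ} (hM : Differentiable ℝ M)
    (hN : Differentiable ℝ N) (hQ : Differentiable ℝ Q) (hp : Differentiable ℝ p) {x : Space}
    (h : IsAxisymSolutionAt M N Q p (meridian x)) :
    convect (axisymField M N Q) (axisymField M N Q) x +
      gradient (fun x => p (meridian x)) x = 0 := by
  obtain ⟨-, e1, e2, e3⟩ := h
  have hm : (meridian x).1 = (x 0 ^ 2 + x 1 ^ 2) / 2 := rfl
  rw [hm] at e1 e2 e3
  rw [convect_eq_fderiv]
  obtain ⟨_, _, _, rfl, rfl, rfl, e0⟩ := fderiv_axisymField hM hN hQ x (axisymField M N Q x)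
  rw [e0]
  have u0 : axisymField M N Q x 0 = x 0 * M (meridian x) - x 1 * N (meridian x) := by
    simp [axisymField]
  have u1 : axisymField M N Q x 1 = x 1 * M (meridian x) + x 0 * N (meridian x) := by
    simp [axisymField]
  have u2 : axisymField M N Q x 2 = Q (meridian x) := by
    simp [axisymField]
  rw [u0, u1, u2]
  ext i
  rw [PiLp.add_apply, gradient_apply, (hasFDerivAt_comp_meridian hp x).fderiv]
  fin_cases i <;> simp [meridianDeriv]
  -- The horizontal Cartesian components are the radial and swirl equations rotated by the angle of
  -- the point.
  · linear_combination x 0 * e1 - x 1 * e2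
  · linear_combination x 1 * e1 + x 0 * e2
  · linear_combination e3

end Gavrilov

open Gavrilov Euler3D Set in
/-- There is a nontrivial, time independent, smooth solution of the three dimensional
incompressible Euler equations whose velocity has compact support, and moreover support in a
toroidal shell around a circle. -/
theorem theorem1p1 :
    ∃ (u : Euler3D.Space → Euler3D.Space) (p : Euler3D.Space → ℝ),
      ContDiff ℝ ∞ u ∧ HasCompactSupport u ∧ u ≠ 0 ∧ ContDiff ℝ ∞ p ∧
      Euler3D.IsEulerSolution (fun _ : ℝ => u) (fun _ : ℝ => p) ∧
      ∃ ℓ a b : ℝ, 0 < a ∧ a < b ∧ b < ℓ ∧ tsupport u ⊆ Euler3D.toroidalShell ℓ a b := by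
  obtain ⟨M, N, Q, p, A, sM, sN, sQ, sp, cA, hA, hcenter, hzero, ⟨q, hqA, hNq⟩, hsol⟩ :=
    exists_meridional_solution
  have su := contDiff_axisymField sM sN sQ
  have sp' : ContDiff ℝ ∞ fun x => p (meridian x) := sp.comp contDiff_meridian
  have dM := sM.differentiable (by simp)
  have dN := sN.differentiable (by simp)
  have dQ := sQ.differentiable (by simp)
  have dp := sp.differentiable (by simp)
  set B : Set Space := meridian ⁻¹' A with hB
  have clB : IsClosed B := cA.isClosed.preimage contDiff_meridian.continuous
  have mem : ∀ x ∈ B, (3 / 4 ≤ (x 0 ^ 2 + x 1 ^ 2) / 2 ∧ (x 0 ^ 2 + x 1 ^ 2) / 2 ≤ 5 / 4) ∧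
      -1 / 4 ≤ x 2 ∧ x 2 ≤ 1 / 4 := fun x hx => hA hx
  have cB : IsCompact B := by
    refine (isCompact_closedBall (0 : Space) 2).of_isClosed_subset clB fun x hx => ?_
    obtain ⟨⟨-, h1⟩, h2, h3⟩ := mem x hx
    rw [mem_closedBall_zero_iff, EuclideanSpace.norm_eq, Real.sqrt_le_iff, Fin.sum_univ_three]
    simp only [Real.norm_eq_abs, sq_abs]
    constructor <;> nlinarith
  have uzero : ∀ x ∉ B, axisymField M N Q x = 0 := fun x hx => by
    obtain ⟨h1, h2, h3⟩ := hzero _ hx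
    simp [axisymField, h1, h2, h3]
  have hts : tsupport (axisymField M N Q) ⊆ B :=
    closure_minimal (fun x hx => by_contra fun hn => hx (uzero x hn)) clB
  have hqw : 0 < q.1 := by linarith [(hA hqA).1.1]
  have hx0 : ∃ x : Space, meridian x = q ∧ x 0 ≠ 0 ∧ x 1 = 0 := by
    refine ⟨!₂[√(2 * q.1), 0, q.2], Prod.ext ?_ ?_, ?_, ?_⟩
    · simp [meridian, mul_pow, Real.sq_sqrt hqw.le]
    · simp [meridian]
    · simp [hqw.ne', hqw.le]
    · simp
  obtain ⟨x, hxq, hx0, hx1⟩ := hx0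
  refine ⟨axisymField M N Q, fun x => p (meridian x), su, HasCompactSupport.intro cB uzero,
    fun h0 => ?_, sp', ⟨?_, ?_, fun t x => ?_, fun t x => ?_⟩, ?_⟩
  · have := congrArg (fun v : Space => v 1) (congrFun h0 x)
    simp [axisymField, hxq, hx0, hx1, hNq] at this
  · exact (su.of_le (by simp)).comp contDiff_snd
  · exact (sp'.of_le (by simp)).comp contDiff_snd
  · rw [deriv_const, zero_add]
    exact momentum_axisymField dM dN dQ dp (hsol _)
  · exact divergence_axisymField dM dN dQ (hsol _)
  -- The core `(w, z) = (1, 0)` is the circle `r = √2`, `z = 0`. The compact set `B` misses it, so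
  -- the squared distance to it has a positive minimum on `B`.
  · have cg : Continuous fun x : Space => (cylRadius x - √2) ^ 2 + x 2 ^ 2 := by
      have := fun i => (contDiff_coord i).continuous
      unfold cylRadius
      fun_prop
    obtain ⟨y, hyB, hy⟩ := cB.exists_isMinOn ⟨x, by rw [hB, mem_preimage, hxq]; exact hqA⟩
      cg.continuousOn
    have s1 : (1.41 : ℝ) ≤ √2 := Real.le_sqrt_of_sq_le (by norm_num)
    have s2 : √2 ≤ (1.42 : ℝ) := Real.sqrt_le_iff.2 (by norm_num)
    set m := (cylRadius y - √2) ^ 2 + y 2 ^ 2 with hm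
    have m0 : 0 < m := by
      refine lt_of_le_of_ne (by positivity) fun h0 => hcenter ?_
      have h2 : y 2 = 0 := by nlinarith [sq_nonneg (cylRadius y - √2), sq_nonneg (y 2)]
      have h3 : cylRadius y = √2 := by
        have : (cylRadius y - √2) ^ 2 = 0 := by
          nlinarith [sq_nonneg (cylRadius y - √2), sq_nonneg (y 2)]
        exact sub_eq_zero.1 (pow_eq_zero_iff two_ne_zero |>.1 this)
      have h4 : y 0 ^ 2 + y 1 ^ 2 = 2 := (Real.sqrt_inj (by positivity) (by norm_num)).1 h3
      have : meridian y = (1, 0) := Prod.ext (by simp [meridian, h4]) h2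
      rw [← this]
      exact hyB
    -- As `m` bounds a squared distance, capping `a` by `1/2` as well gives `a² < a ≤ m`.
    refine ⟨√2, min (1 / 2) m, 1, by positivity, by
      linarith [min_le_left (1 / 2) m], by linarith, fun x hx => ?_⟩
    have hxB := hts hx
    obtain ⟨⟨h1, h2⟩, h3, h4⟩ := mem x hxB
    have hmx : m ≤ (cylRadius x - √2) ^ 2 + x 2 ^ 2 := hy hxB
    have r1 : 1.2 ≤ cylRadius x := Real.le_sqrt_of_sq_le (by norm_num; linarith)
    have r2 : cylRadius x ≤ 1.6 := Real.sqrt_le_iff.2 ⟨by norm_num, by norm_num; linarith⟩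
    refine ⟨lt_of_lt_of_le ?_ hmx, ?_⟩
    · have a0 : 0 < min (1 / 2) m := by positivity
      nlinarith [min_le_left (1 / 2) m, min_le_right (1 / 2) m]
    · nlinarith
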